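/- Notation. Let $W_n=\{x\in\mathbb Z^n: x_1<\dots<x_n\}$, and for $x\in W_n$, $y\in W_{n+1}$ write $x\prec y$ if $y_1<x_1\le y_2<x_2\le\dots<x_n\le y_{n+1}$. Let $GT_N$ be the set of $(x^1,\dots,x^N)$ with $x^n\in W_n$ and $x^n\prec x^{n+1}$. The continuous-time interlacing (Charlier) dynamics on $GT_N$ is the following Markov chain: the particles $x_k^n$, $1\le k\le n\le N$, have independent exponential clocks of rate $1$; when the clock of $x_k^n$ rings, it jumps to the right by one, unless $k\le n-1$ and $x_k^n+1=x_k^{n-1}$, in which case it is blocked and nothing happens; if it jumps and $x_{k+1}^{n+1}=x_k^n$ before the jump, then $x_{k+1}^{n+1}$ is pushed to the right by one at the same moment, and pushes $x_{k+2}^{n+2}$ in the same way if that one is at the same site, and so on. Consider this process started from the packed initial condition $x_k^n(0)=-n-1+k$, $1\le k\le n\le N$. For levels $n\ge1$ and times $t\geq 0$ write $(n,t)\prec(n',t')$ if $n\ge n'$, $t\le t'$ and $(n,t)\ne(n',t')$. Let $m\ge1$ and let $(n_1,t_1)\prec(n_2,t_2)\prec\dots\prec(n_m,t_m)$ be space-like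 points with $1\le n_m$, $n_1\le N$ and $t_1>0$. For $0\le n\le n_1$ let $c(n)=\#\{i: n_i=n\}$, let $t_1^n<\dots<t_{c(n)}^n$ be the times $t_i$ with $n_i=n$, and put $t_0^{n_1}=t_1$ and $t_0^n=t_{c(n+1)}^{n+1}$ for $n<n_1$, so that $t_0^n\le t_1^n<\dots<t_{c(n)}^n$. For $t\ge0$ and $x\in\mathbb Z$ put $\omega_t(x)=e^{-t}t^x/x!$ if $x\ge0$ and $\omega_t(x)=0$ if $x<0$ (with $0^0=1$), and for $x,y\in\mathbb Z$ put $p_t(x,y)=\omega_t(y-x)$ (so $p_0(x,y)=\mathbf 1_{x=y}$) and $\phi(x,y)=\mathbf 1_{y\ge x}$. Set $\phi(x_n^{n-1}(\cdot),y)=1$ for the virtual variables $x_n^{n-1}$, and $\Delta_n(x)=\prod_{1\le i<j\le n}(x_j-x_i)$. Proposition. There is a normalizing constant $\mathrm{const}$, depending only on the points $(n_i,t_i)$, such that $$ \mathrm{const}\,\prod_{n=1}^{n_1}\bigg[\det\big[\phi(x_i^{n-1}(t_0^{n-1}),x_j^n(t_{c(n)}^n))\big]_{i,j=1}^n\ \prod_{a=1}^{c(n)}\det\big[p_{t_a^n-t_{a-1}^n}(x_i^n(t_{a-1}^n),x_j^n(t_a^n))\big]_{i,j=1}^n\bigg]\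 \Delta_{n_1}\big(x^{n_1}(t_0^{n_1})\big)\prod_{i=1}^{n_1}\omega_{t_1}\big(x_i^{n_1}(t_0^{n_1})+n_1\big) $$ is a probability measure on the set of families $(x^n(t_a^n))_{1\le n\le n_1,\,0\le a\le c(n)}$ with $x^n(t_a^n)\in W_n$ (one variable for each pair $(n,a)$, also where two of the times coincide), and the joint distribution of $$(x^{n_1}(t_1),\dots,x^{n_m}(t_m))$$ is its marginal on the variables $x^{n}(t_a^{n})$, $1\le a\le c(n)$, that correspond to the observed points. -/

import Mathlib

open MeasureTheory
open scoped NNReal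

noncomputable section

namespace GTDynamics

/-! ### Interlacing configurations -/

/-- The Weyl chamber `W_n = {x ∈ ℤⁿ : x_1 < x_2 < ⋯ < x_n}`. -/
def Weyl (n : ℕ) : Type := {x : Fin n → ℤ // StrictMono x}

instance (n : ℕ) : CoeFun (Weyl n) (fun _ => Fin n → ℤ) := ⟨Subtype.val⟩

/-- Interlacing `x ≺ y` of a level with `n` particles and one with `n + 1` particles:
`y_1 < x_1 ≤ y_2 < x_2 ≤ ⋯ < x_n ≤ y_{n+1}`. -/
def Interlaces {n : ℕ} (x : Fin n → ℤ) (y : Fin (n + 1) → ℤ) : Prop :=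
  ∀ k : Fin n, y k.castSucc < x k ∧ x k ≤ y k.succ

/-- Triangular arrays of integers with levels `0, 1, …, N`; level `n` has `n` entries (so that
level `0` is void).  Entry `k : Fin n` of level `n` is `x_{k+1}^n`. -/
abbrev Arr (N : ℕ) : Type := (n : Fin (N + 1)) → Fin (n : ℕ) → ℤ

/-- A triangular array is a Gelfand-Tsetlin pattern if `x^n ∈ W_n` for all `n` and
`x^n ≺ x^{n+1}` for all `n < N`. -/
def IsGT {N : ℕ} (x : Arr N) : Prop :=
  (∀ n, StrictMono (x n)) ∧
    ∀ n : Fin N, Interlaces (n := (n : ℕ)) (x n.castSucc) (x n.succ)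

/-- The state space `GT_N` of interlacing configurations with `N` levels. -/
def GT (N : ℕ) : Type := {x : Arr N // IsGT x}

/-- The level `x^n ∈ W_n` of a pattern in `GT_N`, for `n ≤ N`. -/
def GT.level {N : ℕ} (x : GT N) (n : ℕ) (hn : n ≤ N) : Weyl n :=
  ⟨x.1 ⟨n, Nat.lt_succ_of_le hn⟩, x.2.1 ⟨n, Nat.lt_succ_of_le hn⟩⟩

/-- The packed configuration `x_k^n = -n - 1 + k`, `1 ≤ k ≤ n ≤ N` (with `k` shifted by one). -/
def packed (N : ℕ) : GT N :=
  ⟨fun n k => -(n : ℤ) - 1 + ((k : ℕ) + 1 : ℤ), by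
    refine ⟨fun n i j hij => ?_, fun n k => ?_⟩
    · have : (i : ℕ) < (j : ℕ) := hij
      simp only
      omega
    · simp only [Fin.val_castSucc, Fin.val_succ]
      constructor <;> push_cast <;> omega⟩

/-! ### The dynamics with blocking and pushing -/

/-- The particles `x_k^n`, `1 ≤ k ≤ n ≤ N`, of an array; each one carries its own clock. -/
abbrev Particle (N : ℕ) : Type := (n : Fin (N + 1)) × Fin (n : ℕ)

/-- `x_k^n` is blocked if its jump by one to the right would lead to `x_k^n = x_k^{n-1}`
(where `x_k^{n-1}` exists iff `k ≤ n - 1`). -/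
def Blocked {N : ℕ} (x : Arr N) (p : Particle N) : Prop :=
  ∃ (l : Fin (N + 1)) (j : Fin (l : ℕ)),
    (l : ℕ) + 1 = (p.1 : ℕ) ∧ (j : ℕ) = (p.2 : ℕ) ∧ x p.1 p.2 + 1 = x l j

/-- Particle `q` moves together with `p = x_k^n` if `q` is one of the particles
`x_k^n, x_{k+1}^{n+1}, x_{k+2}^{n+2}, …` and sits at the same site as `p`: in a pattern
`x_k^n ≤ x_{k+1}^{n+1} ≤ ⋯`, and a jump of `p` pushes `x_{k+1}^{n+1}` if they are at the same
site, which in turn pushes `x_{k+2}^{n+2}` if they are at the same site, and so on. -/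
def Carried {N : ℕ} (x : Arr N) (p q : Particle N) : Prop :=
  (p.1 : ℕ) ≤ (q.1 : ℕ) ∧ (q.2 : ℕ) + (p.1 : ℕ) = (p.2 : ℕ) + (q.1 : ℕ) ∧
    x q.1 q.2 = x p.1 p.2

open Classical in
/-- The array after the clock of particle `p` has rung: nothing happens if `p` is blocked,
otherwise `p` and the particles it pushes move to the right by one. -/
def ringArr {N : ℕ} (p : Particle N) (x : Arr N) : Arr N := fun n k =>
  if ¬ Blocked x p ∧ Carried x p ⟨n, k⟩ then x n k + 1 else x n k

theorem isGT_ringArr {N : ℕ} (p : Particle N) {x : Arr N} (hx : IsGT x) :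
    IsGT (ringArr p x) := by
  classical
  by_cases hb : Blocked x p
  · have : ringArr p x = x := by
      funext n k
      simp [ringArr, hb]
    rwa [this]
  -- the array as a function of two natural numbers
  set F : ℕ → ℕ → ℤ := fun n i =>
    if h : n < N + 1 ∧ i < n then x ⟨n, h.1⟩ ⟨i, h.2⟩ else 0 with hF
  have F_eq : ∀ (n : Fin (N + 1)) (i : Fin (n : ℕ)), x n i = F n i := by
    intro n i
    simp only [hF]
    rw [dif_pos ⟨n.isLt, i.isLt⟩]
  have F_int : ∀ n i, n + 1 < N + 1 → i < n →
      F (n + 1) i < F n i ∧ F n i ≤ F (n + 1) (i + 1) := by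
    intro n i hn hi
    have h := hx.2 ⟨n, by omega⟩ ⟨i, hi⟩
    simp only [hF]
    rw [dif_pos ⟨hn, by omega⟩, dif_pos ⟨by omega, hi⟩, dif_pos ⟨hn, by omega⟩]
    exact h
  obtain ⟨pn, pk⟩ := p
  set v : ℤ := F pn pk with hv
  have hpn := pn.isLt
  have hpk := pk.isLt
  have hnb : ∀ l, l + 1 = (pn : ℕ) → (pk : ℕ) < l → F l pk ≠ v + 1 := by
    intro l hl hk he
    apply hb
    refine ⟨⟨l, by omega⟩, ⟨pk, hk⟩, hl, rfl, ?_⟩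
    rw [F_eq, F_eq]
    exact he.symm
  have chain : ∀ r, (pn : ℕ) + r < N + 1 → v ≤ F (pn + r) (pk + r) := by
    intro r
    induction r with
    | zero => intro _; simp [hv]
    | succ r ih =>
      intro h
      exact (ih (by omega)).trans (F_int (pn + r) (pk + r) (by omega) (by omega)).2
  have gap : ∀ r, (pn : ℕ) + r < N + 1 → F (pn + r) (pk + r) = v → (pk : ℕ) + 1 < pn →
      v + 1 < F (pn + r) (pk + r + 1) := by
    intro r
    induction r with
    | zero =>
      intro _ _ h
      obtain ⟨l, hl⟩ : ∃ l, (pn : ℕ) = l + 1 := ⟨pn - 1, by omega⟩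
      have h1 := hnb l hl.symm (by omega)
      have h2 := F_int l pk (by omega) (by omega)
      rw [← hl] at h2
      simp only [Nat.add_zero]
      omega
    | succ r ih =>
      intro h1 h2 h3
      have h4 := F_int (pn + r) (pk + r) (by omega) (by omega)
      have h5 := chain r (by omega)
      have h6 := ih (by omega) (by rw [← Nat.add_assoc, ← Nat.add_assoc] at h2; omega) h3
      have h7 := F_int (pn + r) (pk + r + 1) (by omega) (by omega)
      have h8 := h7.2
      have e : (pn : ℕ) + (r + 1) = pn + r + 1 := rfl
      have e' : (pk : ℕ) + (r + 1) + 1 = pk + r + 1 + 1 := rfl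
      rw [e, e']
      omega
  have y_eq : ∀ (n : Fin (N + 1)) (i : Fin (n : ℕ)), ringArr ⟨pn, pk⟩ x n i =
      if (pn : ℕ) ≤ n ∧ (i : ℕ) + pn = pk + n ∧ F n i = v then F n i + 1 else F n i := by
    intro n i
    simp only [ringArr, hb, not_false_eq_true, true_and, Carried, F_eq, ← hv]
  have hint : ∀ n : Fin N, Interlaces (n := (n : ℕ)) (ringArr ⟨pn, pk⟩ x n.castSucc)
      (ringArr ⟨pn, pk⟩ x n.succ) := by
    intro n i
    have hn := n.isLt
    have hi : (i : ℕ) < n := i.isLt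
    have h1 := F_int n i (by omega) hi
    refine ⟨?_, ?_⟩
    · rw [y_eq, y_eq]
      simp only [Fin.val_castSucc, Fin.val_succ]
      split_ifs with ha hc hc
      · omega
      · obtain ⟨ha1, ha2, ha3⟩ := ha
        rcases Nat.lt_or_ge (n : ℕ) pn with hlt | hge
        · have e : (n : ℕ) + 1 = pn := by omega
          have e2 : (i : ℕ) = pk := by omega
          have h2 := hnb n e (by omega)
          rw [e2] at h1 ha3 ⊢
          omega
        · obtain ⟨r, hr⟩ := Nat.exists_eq_add_of_le hge
          have e2 : (i : ℕ) = pk + r + 1 := by omega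
          have h2 := chain r (by omega)
          have h3 := F_int (pn + r) (pk + r) (by omega) (by omega)
          have h4 := gap r (by omega)
          rw [e2, hr] at ha3 ⊢
          have h5 := h4 (by omega) (by omega)
          omega
      · omega
      · omega
    · rw [y_eq, y_eq]
      simp only [Fin.val_castSucc, Fin.val_succ]
      split_ifs with ha hc hc
      · omega
      · obtain ⟨ha1, ha2, ha3⟩ := ha
        have : F (n + 1) (i + 1) ≠ v := fun h => hc ⟨by omega, by omega, h⟩
        omega
      · omega
      · omega
  refine ⟨fun n => ?_, hint⟩
  obtain ⟨n, hn⟩ := n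
  rcases n with _ | n
  · exact fun i => i.elim0
  · refine Fin.strictMono_iff_lt_succ.2 fun i => ?_
    have h := hint ⟨n, by omega⟩ i
    exact lt_of_lt_of_le h.1 h.2

/-- The configuration after the clock of particle `p` has rung. -/
def ring {N : ℕ} (p : Particle N) (x : GT N) : GT N :=
  ⟨ringArr p x.1, isGT_ringArr p x.2⟩

open Classical in
/-- The number of words of `r` clock rings that lead from `x` to `y`. -/
def ringCount {N : ℕ} : ℕ → GT N → GT N → ℕ
  | 0, x, y => if x = y then 1 else 0
  | r + 1, x, y => ∑ p : Particle N, ringCount r (ring p x) y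

/-- The transition probability from `x` to `y` in time `t` of the continuous-time Markov chain on
`GT_N` in which all particles have independent clocks ringing at rate `1`.  It is the entry
`(x, y)` of `exp (t L)`, where `(L f)(x) = ∑ p, (f (ring p x) - f x)` is the generator, that is of
`e^{-Rt} exp (t A)`, with `R = N (N + 1) / 2` the number of particles and
`A(x, y) = #{p : ring p x = y}`. -/
def transProb {N : ℕ} (t : ℝ≥0) (x y : GT N) : ℝ :=
  Real.exp (-((Fintype.card (Particle N) : ℝ) * t)) *
    ∑' r : ℕ, (t : ℝ) ^ r / (r.factorial : ℝ) * (ringCount r x y : ℝ)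

/-- `X` is the interlacing dynamics on `GT_N` started from the packed initial condition: a
continuous-time Markov chain with transition probabilities `transProb` and `X(0) = packed`. -/
structure IsPackedDynamics {Ω : Type*} [MeasurableSpace Ω] (μ : Measure Ω) {N : ℕ}
    (X : ℝ≥0 → Ω → GT N) : Prop where
  measurable : ∀ t x, MeasurableSet {ω | X t ω = x}
  initial : ∀ᵐ ω ∂μ, X 0 ω = packed N
  markov : ∀ (r : ℕ) (s : Fin (r + 1) → ℝ≥0), Monotone s → ∀ x : Fin (r + 1) → GT N,
    μ.real {ω | ∀ i, X (s i) ω = x i} =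
      μ.real {ω | X (s 0) ω = x 0} *
        ∏ i : Fin r, transProb (s i.succ - s i.castSucc) (x i.castSucc) (x i.succ)

/-! ### Space-like points -/

/-- `(n, t) ≺ (n', t')` iff `n ≥ n'`, `t ≤ t'` and `(n, t) ≠ (n', t')`. -/
def SpaceLike (a b : ℕ × ℝ≥0) : Prop := b.1 ≤ a.1 ∧ a.2 ≤ b.2 ∧ a ≠ b

theorem SpaceLike.level_le_top {m : ℕ} [NeZero m] {lev : Fin m → ℕ} {tm : Fin m → ℝ≥0}
    (h : ∀ i j, i < j → SpaceLike (lev i, tm i) (lev j, tm j)) (i : Fin m) : lev i ≤ lev 0 := by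
  rcases eq_or_ne i 0 with rfl | hi
  · exact le_rfl
  · exact (h 0 i (Fin.pos_iff_ne_zero.2 hi)).1

/-- `c(n)`, the number of observation points at level `n`. -/
def numAt {m : ℕ} (lev : Fin m → ℕ) (n : ℕ) : ℕ :=
  (Finset.univ.filter fun i => lev i = n).card

/-- The number of observation points at levels higher than `n`. -/
def numAbove {m : ℕ} (lev : Fin m → ℕ) (n : ℕ) : ℕ :=
  (Finset.univ.filter fun i => n < lev i).card

theorem numAbove_add_numAt_le {m : ℕ} (lev : Fin m → ℕ) (n : ℕ) :
    numAbove lev n + numAt lev n ≤ m := by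
  unfold numAbove numAt
  rw [← Finset.card_union_of_disjoint]
  · simpa using Finset.card_le_univ
      ((Finset.univ.filter fun i => n < lev i) ∪ (Finset.univ.filter fun i => lev i = n))
  · rw [Finset.disjoint_filter]
    intro i _ h
    omega

/-- The times `t_0^n ≤ t_1^n < ⋯ < t_{c(n)}^n` of level `n`.  Along space-like points the levels
decrease, hence the points at level `n` come right after the `numAbove lev n` points at higher
levels.  So `t_a^n`, `1 ≤ a ≤ c(n)`, is the `a`-th observation time at level `n`, and `t_0^n` is
the last observation time at the levels higher than `n`, that is `t_0^n = t_{c(n+1)}^{n+1}`; at the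
top level, where there is no such time, it is the first observation time. -/
def levelTime {m : ℕ} [NeZero m] (lev : Fin m → ℕ) (tm : Fin m → ℝ≥0) (n : ℕ)
    (a : Fin (numAt lev n + 1)) : ℝ≥0 :=
  if (a : ℕ) = 0 ∧ numAbove lev n = 0 then tm 0
  else tm ⟨numAbove lev n + (a : ℕ) - 1, by
    have h1 := numAbove_add_numAt_le lev n
    have h2 := a.isLt
    have h3 := NeZero.pos m
    omega⟩

/-- The index `a ∈ {1, …, c(n_i)}` such that the point `(n_i, t_i)` is the `a`-th one at its
level. -/
def rankAt {m : ℕ} (lev : Fin m → ℕ) (i : Fin m) : Fin (numAt lev (lev i) + 1) :=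
  ⟨(Finset.univ.filter fun j => j ≤ i ∧ lev j = lev i).card, by
    refine Nat.lt_succ_of_le (Finset.card_le_card fun j => ?_)
    simp only [Finset.mem_filter, Finset.mem_univ, true_and]
    exact fun h => h.2⟩

/-! ### The product measure -/

/-- `ω_t(x) = e^{-t} t^x / x!`, which is `0` for `x < 0`. -/
def poissonWeight (t : ℝ≥0) (x : ℤ) : ℝ :=
  if 0 ≤ x then Real.exp (-(t : ℝ)) * (t : ℝ) ^ x.toNat / (x.toNat.factorial : ℝ) else 0

/-- The one-particle transition probability `p_t(x, y) = p_t(y - x)` of a Poisson process. -/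
def poissonKernel (t : ℝ≥0) (x y : ℤ) : ℝ := poissonWeight t (y - x)

/-- `φ(x, y) = 1` if `y ≥ x` and `0` otherwise. -/
def phi (x y : ℤ) : ℝ := if x ≤ y then 1 else 0

/-- `det [φ(x_i^{n-1}, x_j^n)]_{i,j=1}^n` for `n = l + 1`, where `x_n^{n-1}` is the virtual
variable, for which `φ(virt, y) = 1`. -/
def phiDet {l : ℕ} (x : Fin l → ℤ) (y : Fin (l + 1) → ℤ) : ℝ :=
  Matrix.det (Matrix.of fun i j : Fin (l + 1) =>
    if h : (i : ℕ) < l then phi (x ⟨i, h⟩) (y j) else 1)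

/-- `det [p_t(x_i, y_j)]_{i,j=1}^n`. -/
def poissonDet {n : ℕ} (t : ℝ≥0) (x y : Fin n → ℤ) : ℝ :=
  Matrix.det (Matrix.of fun i j : Fin n => poissonKernel t (x i) (y j))

/-- The Vandermonde determinant `Δ_n(x) = ∏_{i < j} (x_j - x_i)`. -/
def vandermonde {n : ℕ} (x : Fin n → ℤ) : ℝ :=
  ∏ i : Fin n, ∏ j ∈ Finset.Ioi i, ((x j : ℝ) - (x i : ℝ))

/-- The configurations on which the product measure lives: one `x^n(t_a^n) ∈ W_n` for each level
`n ≤ n_1` and each `0 ≤ a ≤ c(n)`. (At the void level `0` there is only one choice.) -/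
abbrev Config {m : ℕ} [NeZero m] (lev : Fin m → ℕ) : Type :=
  (n : Fin (lev 0 + 1)) → Fin (numAt lev n + 1) → Weyl n

/-- The weight
`∏_{n=1}^{n_1} (det[φ(x_i^{n-1}(t_0^{n-1}), x_j^n(t_{c(n)}^n))]
  × ∏_{a=1}^{c(n)} det[p_{t_a^n - t_{a-1}^n}(x_i^n(t_{a-1}^n), x_j^n(t_a^n))])
  × Δ_{n_1}(x^{n_1}(t_0^{n_1})) ∏_{i=1}^{n_1} ω_{t_1}(x_i^{n_1}(t_0^{n_1}) + n_1)`. -/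
def weight {m : ℕ} [NeZero m] (lev : Fin m → ℕ) (tm : Fin m → ℝ≥0) (z : Config lev) : ℝ :=
  (∏ l : Fin (lev 0),
    (phiDet (l := (l : ℕ)) (z l.castSucc 0) (z l.succ (Fin.last _)) *
      ∏ a : Fin (numAt lev (l.succ : Fin (lev 0 + 1))),
        poissonDet (levelTime lev tm _ a.succ - levelTime lev tm _ a.castSucc)
          (z l.succ a.castSucc) (z l.succ a.succ))) *
  vandermonde (z (Fin.last _) 0) *
  ∏ i : Fin (lev 0), poissonWeight (tm 0) (z (Fin.last _) 0 i + (lev 0 : ℤ))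

/-- The coordinates `(x^{n_1}(t_1), …, x^{n_m}(t_m))` of a configuration. -/
def observed {m : ℕ} [NeZero m] (lev : Fin m → ℕ) (hlev : ∀ i, lev i ≤ lev 0)
    (z : Config lev) (i : Fin m) : Weyl (lev i) :=
  z ⟨lev i, Nat.lt_succ_of_le (hlev i)⟩ (rankAt lev i)

end GTDynamics

end
/-!
Call a law on patterns uniform Gibbs if the probability of a pattern depends on its top level only.
Summed over all patterns with a given top level, the one-step operator of the dynamics acts on such
laws as particles on the top level that are independent but killed when two of them meet: the
configurations in which a jump of the top level is blocked from below compensate those in which it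
is caused by a push. The transition probabilities of the killed particles are the Karlin–McGregor
determinants, so uniform Gibbs laws are preserved and the top level evolves by `poissonDet`.

Forgetting the top level of a uniform Gibbs law leaves a uniform Gibbs law, whose density is the sum
of the old one over the interlacing configurations above; the indicator of interlacing is `phiDet`
up to sign. Walking along the space-like path, one goes forward in time on a level with `poissonDet`
and down to the next level with `phiDet`, and conditioning on an observation of the current level
keeps the law uniform Gibbs. The packed initial condition is a point mass on the only pattern with
its top level, hence uniform Gibbs, and its transition determinant factors into a Vandermonde
product and Poisson weights.
-/

noncomputable section

namespace GTDynamics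

open Function

open scoped Classical ENNReal

/-! ### Interlacing as a determinant -/

section Determinants

variable {ι R : Type*} [LinearOrder ι]

theorem perm_eq_one_of_strictMono [Finite ι] {σ : Equiv.Perm ι} (hσ : StrictMono σ) : σ = 1 := by
  have hrange : Set.range σ = Set.range (id : ι → ι) := by
    rw [σ.surjective.range_eq, Set.range_id]
  exact DFunLike.coe_injective ((hσ.range_inj strictMono_id).1 hrange)

theorem det_eq_prod_diag_of_forall_strictMono [Fintype ι] [CommRing R] (M : Matrix ι ι R)
    (h : ∀ σ : Equiv.Perm ι, (∀ i, M (σ i) i ≠ 0) → StrictMono σ) : M.det = ∏ i, M i i := by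
  rw [Matrix.det_apply', Finset.sum_eq_single 1]
  · simp
  · intro σ _ hσ
    have hnot : ¬ ∀ i, M (σ i) i ≠ 0 := fun hne => hσ (perm_eq_one_of_strictMono (h σ hne))
    push Not at hnot
    obtain ⟨i, hi⟩ := hnot
    exact mul_eq_zero_of_right _ (Finset.prod_eq_zero (Finset.mem_univ i) hi)
  · simp

end Determinants

section Interlacing

variable {l : ℕ} {x : Fin l → ℤ} {y : Fin (l + 1) → ℤ}

theorem phiDet_eq_neg_one_pow_mul_det (x : Fin l → ℤ) (hy : Monotone y) :
    phiDet x y = (-1) ^ l * Matrix.det (Matrix.of fun i j : Fin l =>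
      if y j.castSucc < x i ∧ x i ≤ y j.succ then (1 : ℝ) else 0) := by
  set M : Matrix (Fin (l + 1)) (Fin (l + 1)) ℝ := Matrix.of fun i j =>
    if h : (i : ℕ) < l then phi (x ⟨i, h⟩) (y j) else 1 with hM
  set D : Matrix (Fin (l + 1)) (Fin (l + 1)) ℝ := Matrix.of fun i j =>
    Fin.cases (M i 0) (fun k => M i k.succ - M i k.castSucc) j with hD
  have det_eq_det_sub : M.det = D.det :=
    Matrix.det_eq_of_forall_col_eq_smul_add_pred (fun _ => 1) (fun i => by simp [hD])
      fun i j => by simp [hD]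
  rw [phiDet, ← hM, det_eq_det_sub, Matrix.det_succ_row D (Fin.last l), Fin.sum_univ_succ,
    Finset.sum_eq_zero fun j _ => by simp [hD, hM], add_zero]
  have hsub : D.submatrix (Fin.last l).succAbove (Fin.succAbove 0) = Matrix.of fun i j : Fin l =>
      if y j.castSucc < x i ∧ x i ≤ y j.succ then (1 : ℝ) else 0 := by
    ext i j
    have hyj : y j.castSucc ≤ y j.succ := hy j.castSucc_lt_succ.le
    simp only [hD, hM, Matrix.submatrix_apply, Matrix.of_apply, Fin.succAbove_last,
      Fin.succAbove_zero, Fin.cases_succ, Fin.val_castSucc, Fin.is_lt, dif_pos, phi, Fin.eta]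
    split_ifs <;> first | omega | norm_num
  rw [hsub]
  simp [hD, hM]

theorem det_interlacing_indicator (hx : StrictMono x) (hy : Monotone y) :
    Matrix.det (Matrix.of fun i j : Fin l =>
      if y j.castSucc < x i ∧ x i ≤ y j.succ then (1 : ℝ) else 0) =
      if Interlaces x y then 1 else 0 := by
  rw [det_eq_prod_diag_of_forall_strictMono]
  · simp only [Matrix.of_apply, Finset.prod_ite_zero, Finset.prod_const_one, Finset.mem_univ,
      true_imp_iff, Interlaces]
    congr
  · intro σ hσ i j hij
    have hi := hσ i
    have hj := hσ j
    simp only [Matrix.of_apply, ne_eq, ite_eq_right_iff, one_ne_zero, imp_false, not_not] at hi hj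
    have hyij : y i.succ ≤ y j.castSucc := hy (Fin.succ_le_castSucc_iff.2 hij)
    exact hx.lt_iff_lt.1 (hi.2.trans_lt (hyij.trans_lt hj.1))

theorem neg_one_pow_mul_phiDet (hx : StrictMono x) (hy : Monotone y) :
    (-1) ^ l * phiDet x y = if Interlaces x y then 1 else 0 := by
  rw [phiDet_eq_neg_one_pow_mul_det x hy, det_interlacing_indicator hx hy, ← mul_assoc, ← mul_pow]
  simp

end Interlacing

/-! ### Particles killed on collision -/

/-- `1 / d!`, which is `0` for `d < 0`. -/
def invFact (d : ℤ) : ℝ := if 0 ≤ d then ((d.toNat.factorial : ℝ))⁻¹ else 0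

theorem invFact_of_neg {d : ℤ} (h : d < 0) : invFact d = 0 := if_neg h.not_ge

@[simp]
theorem invFact_zero : invFact 0 = 1 := by simp [invFact]

theorem invFact_sub_one (d : ℤ) : invFact (d - 1) = d * invFact d := by
  rcases lt_trichotomy d 0 with h | rfl | h
  · rw [invFact_of_neg h, invFact_of_neg (by omega), mul_zero]
  · simp [invFact]
  · obtain ⟨n, rfl⟩ : ∃ n : ℕ, d = n + 1 := ⟨(d - 1).toNat, by omega⟩
    have htoNat : ((n : ℤ) + 1).toNat = n + 1 := by omega
    rw [invFact, invFact, if_pos (by omega), if_pos (by omega), htoNat, add_sub_cancel_right,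
      Int.toNat_natCast, Nat.factorial_succ]
    push_cast
    field_simp

section InvFactDet

variable {n : ℕ} {a b : Fin n → ℤ}

/-- `det [1 / (b_j - a_i)!]`, the Karlin–McGregor determinant up to powers of the time. -/
def invFactDet (a b : Fin n → ℤ) : ℝ :=
  Matrix.det (Matrix.of fun i j => invFact (b j - a i))

theorem invFactDet_apply (a b : Fin n → ℤ) :
    invFactDet a b = ∑ σ : Equiv.Perm (Fin n), ((Equiv.Perm.sign σ : ℤ) : ℝ) *
      ∏ i, invFact (b i - a (σ i)) := by
  rw [invFactDet, Matrix.det_apply']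
  rfl

theorem invFactDet_of_not_injective (b : Fin n → ℤ) (ha : ¬ Injective a) : invFactDet a b = 0 := by
  obtain ⟨i, j, hij, hne⟩ := not_injective_iff.1 ha
  exact Matrix.det_zero_of_row_eq hne (by ext k; simp [hij])

theorem prod_invFact_add_single (a b : Fin n → ℤ) (σ : Equiv.Perm (Fin n)) (k : Fin n) :
    ∏ i, invFact (b i - (a + Pi.single (σ k) 1 : Fin n → ℤ) (σ i)) =
      ((b k - a (σ k) : ℤ) : ℝ) * ∏ i, invFact (b i - a (σ i)) := by
  rw [← Finset.mul_prod_erase _ _ (Finset.mem_univ k),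
    ← Finset.mul_prod_erase _ (fun i => invFact (b i - a (σ i))) (Finset.mem_univ k), ← mul_assoc,
    ← invFact_sub_one]
  congr 1
  · simp [sub_sub]
  · refine Finset.prod_congr rfl fun i hi => ?_
    simp [Pi.single_eq_of_ne (σ.injective.ne (Finset.ne_of_mem_erase hi))]

theorem sum_invFactDet_add_single (a b : Fin n → ℤ) :
    ∑ k, invFactDet (a + Pi.single k 1) b = ((∑ i, b i - ∑ i, a i : ℤ) : ℝ) * invFactDet a b := by
  simp only [invFactDet_apply]
  rw [Finset.sum_comm, Finset.mul_sum]
  refine Finset.sum_congr rfl fun σ _ => ?_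
  rw [← Finset.mul_sum, ← Equiv.sum_comp σ]
  simp only [prod_invFact_add_single]
  rw [← Finset.sum_mul, ← Int.cast_sum, Finset.sum_sub_distrib, Equiv.sum_comp σ a]
  ring

theorem invFactDet_of_sum_le (ha : StrictMono a) (hb : StrictMono b) (h : ∑ i, b i ≤ ∑ i, a i) :
    invFactDet a b = if a = b then 1 else 0 := by
  have apply_eq_of_prod_ne_zero : ∀ σ : Equiv.Perm (Fin n),
      (∀ i, invFact (b i - a (σ i)) ≠ 0) → ∀ i, a (σ i) = b i := by
    intro σ hσ
    have hle : ∀ i, a (σ i) ≤ b i := fun i => by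
      by_contra hlt
      exact hσ i (invFact_of_neg (by omega))
    have hsum : ∑ i, a (σ i) = ∑ i, b i :=
      le_antisymm (Finset.sum_le_sum fun i _ => hle i) (by rwa [Equiv.sum_comp σ a])
    exact fun i => (Finset.sum_eq_sum_iff_of_le fun i _ => hle i).1 hsum i (Finset.mem_univ i)
  have hdiag : invFactDet a b = ∏ i, invFact (b i - a i) := by
    refine det_eq_prod_diag_of_forall_strictMono _ fun σ hσ i j hij => ?_
    rw [← ha.lt_iff_lt, apply_eq_of_prod_ne_zero σ hσ i, apply_eq_of_prod_ne_zero σ hσ j]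
    exact hb hij
  rw [hdiag]
  split_ifs with hab
  · simp [hab]
  · by_contra hne
    exact hab (funext (apply_eq_of_prod_ne_zero 1 fun i => Finset.prod_ne_zero_iff.1 hne i
      (Finset.mem_univ i)))

theorem invFactDet_of_sum_lt (ha : StrictMono a) (hb : StrictMono b)
    (h : ∑ i, b i < ∑ i, a i) : invFactDet a b = 0 := by
  rw [invFactDet_of_sum_le ha hb h.le, if_neg]
  rintro rfl
  exact lt_irrefl _ h

theorem strictMono_or_not_injective_add_single (ha : StrictMono a) (i : Fin n) :
    StrictMono (a + Pi.single i 1) ∨ ¬ Injective (a + Pi.single i 1) := by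
  by_contra! h
  refine h.1 (Monotone.strictMono_of_injective (fun j k hjk => ?_) h.2)
  rcases hjk.lt_or_eq with hlt | rfl
  · have := ha hlt
    simp only [Pi.add_apply, Pi.single_apply]
    split_ifs <;> omega
  · exact le_rfl

/-- The number of ways to move from `a` to `b` in `r` steps, in each of which one of the particles
jumps to the right by one, if the particles are killed as soon as two of them are at the same
site. -/
def nonCollidingPathCount : ℕ → (Fin n → ℤ) → (Fin n → ℤ) → ℕ
  | 0, a, b => if a = b then 1 else 0
  | r + 1, a, b => if StrictMono a then ∑ i, nonCollidingPathCount r (a + Pi.single i 1) b else 0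

theorem nonCollidingPathCount_of_not_strictMono (r : ℕ) (ha : ¬ StrictMono a) (hb : StrictMono b) :
    nonCollidingPathCount r a b = 0 := by
  cases r with
  | zero => exact if_neg (by rintro rfl; exact ha hb)
  | succ r => exact if_neg ha

theorem sum_factorial_mul_invFactDet_add_single (a b : Fin n → ℤ) (r : ℕ) :
    (∑ i, if ∑ k, b k - ∑ k, (a + Pi.single i 1 : Fin n → ℤ) k = r then
        (r.factorial : ℝ) * invFactDet (a + Pi.single i 1) b else 0) =
      if ∑ k, b k - ∑ k, a k = (r + 1 : ℕ) then
        ((r + 1).factorial : ℝ) * invFactDet a b else 0 := by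
  have hsum : ∀ i : Fin n, ∑ k, (a + Pi.single i 1 : Fin n → ℤ) k = ∑ k, a k + 1 := fun i => by
    simp [Finset.sum_add_distrib]
  have hiff : ∑ k, b k - (∑ k, a k + 1) = (r : ℤ) ↔ ∑ k, b k - ∑ k, a k = (r + 1 : ℕ) := by
    push_cast
    omega
  simp only [hsum, hiff]
  split_ifs with h
  · rw [← Finset.mul_sum, sum_invFactDet_add_single, h, Nat.factorial_succ]
    push_cast
    ring
  · exact Finset.sum_const_zero

theorem nonCollidingPathCount_eq (r : ℕ) (ha : StrictMono a ∨ ¬ Injective a) (hb : StrictMono b) :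
    (nonCollidingPathCount r a b : ℝ) =
      if ∑ k, b k - ∑ k, a k = r then (r.factorial : ℝ) * invFactDet a b else 0 := by
  rcases ha with ha | ha
  swap
  · rw [nonCollidingPathCount_of_not_strictMono r (fun h => ha h.injective) hb,
      invFactDet_of_not_injective b ha]
    simp
  induction r generalizing a with
  | zero =>
    rw [nonCollidingPathCount]
    split_ifs with hab hsum hsum
    · rw [invFactDet_of_sum_le ha hb (by simp [hab]), if_pos hab]
      simp
    · simp [hab] at hsum
    · simp [invFactDet_of_sum_le ha hb (by simp at hsum; omega), hab]
    · simp
  | succ r ih =>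
    rw [nonCollidingPathCount, if_pos ha, Nat.cast_sum,
      ← sum_factorial_mul_invFactDet_add_single]
    refine Finset.sum_congr rfl fun i _ => ?_
    rcases strictMono_or_not_injective_add_single ha i with hi | hi
    · exact ih hi
    · rw [nonCollidingPathCount_of_not_strictMono r (fun h => hi h.injective) hb,
        invFactDet_of_not_injective b hi]
      simp

theorem invFactDet_nonneg (ha : StrictMono a) (hb : StrictMono b) : 0 ≤ invFactDet a b := by
  rcases lt_or_ge (∑ i, b i) (∑ i, a i) with h | h
  · rw [invFactDet_of_sum_lt ha hb h]
  · have hcount := nonCollidingPathCount_eq (∑ i, b i - ∑ i, a i).toNat (Or.inl ha) hb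
    rw [if_pos (by omega)] at hcount
    exact nonneg_of_mul_nonneg_right (hcount ▸ Nat.cast_nonneg _) (by positivity)

end InvFactDet

/-! ### Determinants of Poisson kernels -/

section Poisson

variable {n : ℕ}

theorem poissonWeight_eq (t : ℝ≥0) (d : ℤ) :
    poissonWeight t d = Real.exp (-(t : ℝ)) * ((t : ℝ) ^ d.toNat * invFact d) := by
  unfold poissonWeight invFact
  split_ifs
  · rw [div_eq_mul_inv, mul_assoc]
  · simp

theorem prod_pow_toNat_mul_invFact {ι : Type*} [Fintype ι] (t : ℝ) (d : ι → ℤ) :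
    ∏ i, (t ^ (d i).toNat * invFact (d i)) = t ^ (∑ i, d i).toNat * ∏ i, invFact (d i) := by
  by_cases h : ∀ i, 0 ≤ d i
  · have hsum : (∑ i, d i).toNat = ∑ i, (d i).toNat := by
      zify
      rw [Int.toNat_of_nonneg (Finset.sum_nonneg fun i _ => h i)]
      exact Finset.sum_congr rfl fun i _ => (Int.toNat_of_nonneg (h i)).symm
    rw [Finset.prod_mul_distrib, Finset.prod_pow_eq_pow_sum, hsum]
  · push Not at h
    obtain ⟨i, hi⟩ := h
    rw [Finset.prod_eq_zero (Finset.mem_univ i) (by rw [invFact_of_neg hi, mul_zero]),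
      Finset.prod_eq_zero (Finset.mem_univ i) (invFact_of_neg hi), mul_zero]

theorem poissonDet_eq (t : ℝ≥0) (a b : Fin n → ℤ) :
    poissonDet t a b = Real.exp (-(n * t : ℝ)) *
      ((t : ℝ) ^ (∑ i, b i - ∑ i, a i).toNat * invFactDet a b) := by
  have hprod : ∀ σ : Equiv.Perm (Fin n),
      ∏ i, (Matrix.of fun i j => poissonKernel t (a i) (b j)) (σ i) i =
        Real.exp (-(n * t : ℝ)) * ((t : ℝ) ^ (∑ i, b i - ∑ i, a i).toNat *
          ∏ i, invFact (b i - a (σ i))) := by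
    intro σ
    simp only [Matrix.of_apply, poissonKernel, poissonWeight_eq]
    rw [Finset.prod_mul_distrib, prod_pow_toNat_mul_invFact, Finset.sum_sub_distrib,
      Equiv.sum_comp σ a, Finset.prod_const, ← Real.exp_nat_mul]
    simp
  rw [poissonDet, Matrix.det_apply', invFactDet_apply, Finset.mul_sum, Finset.mul_sum]
  refine Finset.sum_congr rfl fun σ _ => ?_
  rw [hprod]
  ring

theorem poissonDet_nonneg (t : ℝ≥0) {a b : Fin n → ℤ} (ha : StrictMono a) (hb : StrictMono b) :
    0 ≤ poissonDet t a b := by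
  rw [poissonDet_eq]
  have := invFactDet_nonneg ha hb
  positivity

theorem poissonWeight_sub_one_mul (t : ℝ≥0) (y : ℤ) :
    poissonWeight t (y - 1) * t = poissonWeight t y * y := by
  rw [poissonWeight_eq, poissonWeight_eq, invFact_sub_one]
  rcases lt_trichotomy y 0 with h | rfl | h
  · simp [invFact_of_neg h]
  · simp
  · have : y.toNat = (y - 1).toNat + 1 := by omega
    rw [this, pow_succ]
    ring

theorem poissonWeight_sub_mul_pow (t : ℝ≥0) (y : ℤ) (i : ℕ) :
    poissonWeight t (y - i) * (t : ℝ) ^ i =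
      poissonWeight t y * (descPochhammer ℝ i).eval (y : ℝ) := by
  induction i with
  | zero => simp
  | succ i ih =>
    have hsub : y - ((i + 1 : ℕ) : ℤ) = (y - i) - 1 := by push_cast; ring
    rw [pow_succ', ← mul_assoc, hsub, poissonWeight_sub_one_mul, descPochhammer_succ_eval,
      ← mul_assoc, ← ih]
    push_cast
    ring

theorem det_descPochhammer_eval_add (x : Fin n → ℤ) (c : ℝ) :
    Matrix.det (Matrix.of fun i j : Fin n => (descPochhammer ℝ j).eval ((x i : ℝ) + c)) =
      vandermonde x := by
  rw [← Matrix.det_eval_matrixOfPolynomials_eq_det_vandermonde (fun i => (x i : ℝ) + c)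
      (fun j => descPochhammer ℝ j) (fun j => descPochhammer_natDegree ℝ j)
      (fun j => monic_descPochhammer ℝ j), Matrix.det_vandermonde]
  simp [vandermonde]

theorem poissonDet_packed {t : ℝ≥0} (ht : t ≠ 0) (x : Fin n → ℤ) :
    poissonDet t (fun i => -(n : ℤ) + (i : ℕ)) x =
      (∏ i : Fin n, ((t : ℝ) ^ (i : ℕ))⁻¹) *
        (vandermonde x * ∏ i, poissonWeight t (x i + n)) := by
  set P : Matrix (Fin n) (Fin n) ℝ :=
    Matrix.of fun i j => (descPochhammer ℝ j).eval ((x i : ℝ) + n) with hP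
  have hmatrix : poissonDet t (fun i => -(n : ℤ) + (i : ℕ)) x =
      Matrix.det (Matrix.of fun i j : Fin n => ((t : ℝ) ^ (i : ℕ))⁻¹ *
        (Matrix.of fun i j : Fin n => poissonWeight t (x j + n) * P.transpose i j) i j) := by
    unfold poissonDet
    congr 1
    ext i j
    have hshift := poissonWeight_sub_mul_pow t (x j + n) i
    push_cast at hshift
    simp only [Matrix.of_apply, Matrix.transpose_apply, poissonKernel, hP]
    rw [eq_inv_mul_iff_mul_eq₀ (pow_ne_zero _ (by exact_mod_cast ht)), mul_comm, ← hshift]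
    congr 2
    ring
  rw [hmatrix, Matrix.det_mul_column, Matrix.det_mul_row, Matrix.det_transpose,
    det_descPochhammer_eval_add, mul_comm (vandermonde x)]

end Poisson

/-! ### Sums over the fibres of a map -/

section FiberSum

variable {α β : Type*}

/-- The sum of `F` over the fibre of `f` above `b`. -/
def fiberSum (f : α → β) (F : α → ℝ≥0∞) (b : β) : ℝ≥0∞ := ∑' a, if f a = b then F a else 0

theorem fiberSum_congr {f : α → β} {F G : α → ℝ≥0∞} {b : β} (h : ∀ a, f a = b → F a = G a) :
    fiberSum f F b = fiberSum f G b :=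
  tsum_congr fun a => by
    split_ifs with ha
    exacts [h a ha, rfl]

theorem fiberSum_eq_zero {f : α → β} {F : α → ℝ≥0∞} {b : β} (h : ∀ a, f a = b → F a = 0) :
    fiberSum f F b = 0 :=
  ENNReal.tsum_eq_zero.2 fun a => by
    split_ifs with ha
    exacts [h a ha, rfl]

theorem tsum_fiberSum (f : α → β) (F : β → α → ℝ≥0∞) :
    ∑' b, fiberSum f (F b) b = ∑' a, F (f a) a := by
  unfold fiberSum
  rw [ENNReal.tsum_comm]
  exact tsum_congr fun a => by rw [tsum_eq_single (f a) fun b hb => if_neg hb.symm, if_pos rfl]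

theorem fiberSum_finsetSum {ι : Type*} (s : Finset ι) (f : α → β) (F : ι → α → ℝ≥0∞) (b : β) :
    fiberSum f (fun a => ∑ i ∈ s, F i a) b = ∑ i ∈ s, fiberSum f (F i) b := by
  unfold fiberSum
  rw [← Summable.tsum_finsetSum fun _ _ => ENNReal.summable]
  refine tsum_congr fun a => ?_
  split_ifs <;> simp

theorem fiberSum_tsum {ι : Type*} (f : α → β) (F : ι → α → ℝ≥0∞) (b : β) :
    fiberSum f (fun a => ∑' i, F i a) b = ∑' i, fiberSum f (F i) b := by
  unfold fiberSum
  rw [ENNReal.tsum_comm]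
  refine tsum_congr fun a => ?_
  split_ifs <;> simp

theorem fiberSum_const_mul (c : ℝ≥0∞) (f : α → β) (F : α → ℝ≥0∞) (b : β) :
    fiberSum f (fun a => c * F a) b = c * fiberSum f F b := by
  simp only [fiberSum, ← ENNReal.tsum_mul_left, mul_ite, mul_zero]

theorem fiberSum_single [DecidableEq α] [DecidableEq β] (f : α → β) (a : α) :
    fiberSum f (Pi.single a 1) = Pi.single (f a) 1 := by
  funext b
  rw [fiberSum, tsum_eq_single a fun a' ha' => by simp [ha']]
  simp [Pi.single_apply, eq_comm]

end FiberSum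

/-! ### Levels of patterns -/

section Levels

variable {n N : ℕ}

/-- The lower `n` levels of a pattern. -/
def GT.proj (x : GT N) (n : ℕ) (hn : n ≤ N) : GT n :=
  ⟨fun j k => x.1 ⟨j, by omega⟩ k, fun j => x.2.1 ⟨j, by omega⟩,
    fun j k => x.2.2 ⟨j, by omega⟩ k⟩

/-- The top level of a pattern. -/
def GT.top (x : GT N) : Fin N → ℤ := x.1 (Fin.last N)

/-- All levels of a pattern but the top one. -/
abbrev GT.init (x : GT (N + 1)) : GT N := x.proj N N.le_succ

theorem GT.strictMono_top (x : GT N) : StrictMono x.top := x.2.1 (Fin.last N)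

theorem GT.interlaces_top (x : GT (N + 1)) : Interlaces x.init.top x.top := x.2.2 (Fin.last N)

theorem GT.ext_apply {x y : GT N} (h : ∀ n k, x.1 n k = y.1 n k) : x = y :=
  Subtype.ext (funext fun n => funext fun k => h n k)

theorem GT.ext_init_top {x y : GT (N + 1)} (hinit : x.init = y.init) (htop : x.top = y.top) :
    x = y := by
  refine GT.ext_apply fun ⟨n, hn⟩ k => ?_
  rcases Nat.lt_or_ge n (N + 1) with h | h
  · exact congrArg (fun w : GT N => w.1 ⟨n, h⟩ k) hinit
  · obtain rfl : n = N + 1 := by omega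
    exact congrFun htop k

theorem Interlaces.strictMono_right {x : Fin n → ℤ} {y : Fin (n + 1) → ℤ}
    (h : Interlaces x y) : StrictMono y :=
  Fin.strictMono_iff_lt_succ.2 fun i => (h i).1.trans_le (h i).2

theorem Interlaces.strictMono_left {x : Fin n → ℤ} {y : Fin (n + 1) → ℤ}
    (h : Interlaces x y) : StrictMono x := by
  rcases n with _ | n
  · exact fun i => i.elim0
  · exact Fin.strictMono_iff_lt_succ.2 fun i =>
      (h i.castSucc).2.trans_lt (by rw [Fin.succ_castSucc]; exact (h i.succ).1)

/-- The pattern with lower levels `z` and top level `y`. -/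
def GT.snoc (z : GT N) (y : Fin (N + 1) → ℤ) (h : Interlaces z.top y) : GT (N + 1) :=
  ⟨fun n k => if hn : (n : ℕ) ≤ N then z.1 ⟨n, by omega⟩ k else y ⟨k, by omega⟩, by
    constructor
    · intro n
      by_cases hn : (n : ℕ) ≤ N
      · simpa only [dif_pos hn] using z.2.1 ⟨n, by omega⟩
      · simp only [dif_neg hn]
        exact fun i j hij => h.strictMono_right hij
    · intro n k
      have hle : (n.castSucc : ℕ) ≤ N := by simp only [Fin.val_castSucc]; omega
      simp only [dif_pos hle]
      by_cases hn : (n.succ : ℕ) ≤ N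
      · simp only [dif_pos hn]
        exact z.2.2 ⟨n, hn⟩ k
      · simp only [dif_neg hn]
        obtain ⟨n, hn'⟩ := n
        simp only [Fin.succ_mk] at hn
        obtain rfl : n = N := by omega
        exact h k⟩

@[simp]
theorem GT.init_snoc (z : GT N) (y : Fin (N + 1) → ℤ) (h : Interlaces z.top y) :
    (z.snoc y h).init = z :=
  GT.ext_apply fun j _ => dif_pos (Nat.le_of_lt_succ j.isLt)

@[simp]
theorem GT.top_snoc (z : GT N) (y : Fin (N + 1) → ℤ) (h : Interlaces z.top y) :
    (z.snoc y h).top = y := by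
  funext k
  simp only [GT.top, GT.snoc]
  rw [dif_neg (by simp)]

theorem GT.snoc_init_top (x : GT (N + 1)) : x.init.snoc x.top x.interlaces_top = x :=
  GT.ext_init_top (GT.init_snoc _ _ _) (GT.top_snoc _ _ _)

/-- The sum of `F` over the configurations `x` which interlace with `y`. -/
def interlacingSum (y : Fin (n + 1) → ℤ) (F : (Fin n → ℤ) → ℝ≥0∞) : ℝ≥0∞ :=
  ∑' x, if Interlaces x y then F x else 0

theorem interlacingSum_congr {y : Fin (n + 1) → ℤ} {F G : (Fin n → ℤ) → ℝ≥0∞}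
    (h : ∀ x, Interlaces x y → F x = G x) : interlacingSum y F = interlacingSum y G :=
  tsum_congr fun x => by
    split_ifs with hx
    exacts [h x hx, rfl]

theorem interlacingSum_eq_tsum {y : Fin (n + 1) → ℤ} {F : (Fin n → ℤ) → ℝ≥0∞}
    (h : ∀ x, ¬ Interlaces x y → F x = 0) : interlacingSum y F = ∑' x, F x :=
  tsum_congr fun x => by
    split_ifs with hx
    exacts [rfl, (h x hx).symm]

theorem interlacingSum_add (y : Fin (n + 1) → ℤ) (F G : (Fin n → ℤ) → ℝ≥0∞) :
    interlacingSum y (fun x => F x + G x) = interlacingSum y F + interlacingSum y G := by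
  unfold interlacingSum
  rw [← ENNReal.tsum_add]
  refine tsum_congr fun x => ?_
  split_ifs <;> simp

theorem interlacingSum_finsetSum {ι : Type*} (s : Finset ι) (y : Fin (n + 1) → ℤ)
    (F : ι → (Fin n → ℤ) → ℝ≥0∞) :
    interlacingSum y (fun x => ∑ i ∈ s, F i x) = ∑ i ∈ s, interlacingSum y (F i) := by
  unfold interlacingSum
  rw [← Summable.tsum_finsetSum fun _ _ => ENNReal.summable]
  refine tsum_congr fun x => ?_
  split_ifs <;> simp

theorem interlacingSum_const_mul (c : ℝ≥0∞) (y : Fin (n + 1) → ℤ) (F : (Fin n → ℤ) → ℝ≥0∞) :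
    interlacingSum y (fun x => c * F x) = c * interlacingSum y F := by
  simp only [interlacingSum, ← ENNReal.tsum_mul_left, mul_ite, mul_zero]

/-- Patterns with a given top level `y` correspond to patterns one level smaller whose top level
interlaces with `y`. -/
def GT.initEquiv (y : Fin (N + 1) → ℤ) :
    {x : GT (N + 1) // x.top = y} ≃ {z : GT N // Interlaces z.top y} where
  toFun x := ⟨x.1.init, by simpa only [x.2] using x.1.interlaces_top⟩
  invFun z := ⟨z.1.snoc y z.2, z.1.top_snoc y z.2⟩
  left_inv := fun ⟨x, hx⟩ => by subst hx; exact Subtype.ext x.snoc_init_top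
  right_inv z := Subtype.ext (z.1.init_snoc y z.2)

theorem fiberSum_top_succ (H : GT N → (Fin (N + 1) → ℤ) → ℝ≥0∞) (y : Fin (N + 1) → ℤ) :
    fiberSum GT.top (fun x : GT (N + 1) => H x.init x.top) y =
      interlacingSum y (fiberSum GT.top fun z => H z y) := by
  have sum_init : fiberSum GT.top (fun x : GT (N + 1) => H x.init x.top) y =
      ∑' z : GT N, if Interlaces z.top y then H z y else 0 := by
    have hdomain := tsum_subtype {x : GT (N + 1) | x.top = y} fun x => H x.init y
    have hcodomain := tsum_subtype {z : GT N | Interlaces z.top y} fun z => H z y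
    simp only [Set.indicator_apply, Set.mem_ofPred_eq] at hdomain hcodomain
    rw [fiberSum_congr fun x hx => congrArg (H x.init) hx]
    unfold fiberSum
    convert hdomain.symm.trans (((GT.initEquiv y).tsum_eq fun z => H z.1 y).trans hcodomain)
  rw [sum_init, ← tsum_fiberSum GT.top fun x z => if Interlaces x y then H z y else 0]
  refine tsum_congr fun x => ?_
  split_ifs
  exacts [rfl, fiberSum_eq_zero fun _ _ => rfl]

/-- The function `f` of a pattern as a function of its lower levels `z` and its top level `y`,
extended by `0` to all pairs `z`, `y` that do not form a pattern. -/
def extendSnoc (f : GT (N + 1) → ℝ≥0∞) (z : GT N) (y : Fin (N + 1) → ℤ) : ℝ≥0∞ :=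
  if h : Interlaces z.top y then f (z.snoc y h) else 0

theorem extendSnoc_init_top (f : GT (N + 1) → ℝ≥0∞) (x : GT (N + 1)) :
    extendSnoc f x.init x.top = f x := by
  rw [extendSnoc, dif_pos x.interlaces_top, x.snoc_init_top]

/-- The sum of `f` over all patterns whose top two levels are `x` and `y`. -/
def topTwoSum (f : GT (N + 1) → ℝ≥0∞) (x : Fin N → ℤ) (y : Fin (N + 1) → ℤ) : ℝ≥0∞ :=
  fiberSum GT.top (fun z => extendSnoc f z y) x

theorem topTwoSum_of_not_interlaces (f : GT (N + 1) → ℝ≥0∞) {x : Fin N → ℤ}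
    {y : Fin (N + 1) → ℤ} (h : ¬ Interlaces x y) : topTwoSum f x y = 0 :=
  fiberSum_eq_zero fun _ hz => dif_neg (hz ▸ h)

theorem tsum_topTwoSum (f : GT (N + 1) → ℝ≥0∞) (y : Fin (N + 1) → ℤ) :
    ∑' x, topTwoSum f x y = fiberSum GT.top f y := by
  rw [← interlacingSum_eq_tsum fun x => topTwoSum_of_not_interlaces f,
    ← fiberSum_congr fun x _ => extendSnoc_init_top f x]
  exact (fiberSum_top_succ (extendSnoc f) y).symm

end Levels

/-! ### Clock rings and levels -/

section Rings

variable {n N : ℕ}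

/-- A particle of the lower `n` levels, as a particle of the full pattern. -/
def liftParticle (hn : n ≤ N) (p : Particle n) : Particle N :=
  ⟨⟨p.1, by omega⟩, p.2⟩

theorem liftParticle_injective (hn : n ≤ N) : Injective (liftParticle hn) := by
  rintro ⟨⟨a, ha⟩, b⟩ ⟨⟨a', ha'⟩, b'⟩ h
  simp only [liftParticle, Sigma.mk.injEq, Fin.mk.injEq] at h
  obtain ⟨rfl, h⟩ := h
  rw [eq_of_heq h]

theorem exists_liftParticle (hn : n ≤ N) (p : Particle N) (hp : (p.1 : ℕ) ≤ n) :
    ∃ p' : Particle n, liftParticle hn p' = p :=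
  ⟨⟨⟨p.1, by omega⟩, p.2⟩, rfl⟩

theorem card_particle (N : ℕ) : Fintype.card (Particle N) = (∑ j : Fin N, (j : ℕ)) + N := by
  rw [Fintype.card_sigma, Fin.sum_univ_castSucc]
  simp

theorem card_particle_le (hn : n ≤ N) : Fintype.card (Particle n) ≤ Fintype.card (Particle N) :=
  Fintype.card_le_of_injective _ (liftParticle_injective hn)

theorem blocked_liftParticle (hn : n ≤ N) (p : Particle n) (x : GT N) :
    Blocked x.1 (liftParticle hn p) ↔ Blocked (x.proj n hn).1 p := by
  constructor
  · rintro ⟨l, j, hl, hj, hx⟩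
    exact ⟨⟨l, by have := p.1.isLt; simp only [liftParticle] at hl; omega⟩, j, hl, hj, hx⟩
  · rintro ⟨l, j, hl, hj, hx⟩
    exact ⟨⟨l, by omega⟩, j, hl, hj, hx⟩

theorem proj_ring_liftParticle (hn : n ≤ N) (p : Particle n) (x : GT N) :
    (ring (liftParticle hn p) x).proj n hn = ring p (x.proj n hn) :=
  GT.ext_apply fun _ _ =>
    if_congr (and_congr (not_congr (blocked_liftParticle hn p x)) Iff.rfl) rfl rfl

theorem proj_ring_of_lt (hn : n ≤ N) {p : Particle N} (hp : n < (p.1 : ℕ)) (x : GT N) :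
    (ring p x).proj n hn = x.proj n hn :=
  GT.ext_apply fun j _ => if_neg fun h => by
    have hpj : (p.1 : ℕ) ≤ j := h.2.1
    omega

theorem sum_proj_ring {M : Type*} [AddCommMonoid M] (hn : n ≤ N) (f : GT n → M) (x : GT N) :
    ∑ p : Particle N, f ((ring p x).proj n hn) =
      ∑ p : Particle n, f (ring p (x.proj n hn)) +
        (Fintype.card (Particle N) - Fintype.card (Particle n)) • f (x.proj n hn) := by
  rw [← Finset.sum_add_sum_compl (Finset.univ.map ⟨_, liftParticle_injective hn⟩), Finset.sum_map]
  congr 1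
  · exact Finset.sum_congr rfl fun p _ => congrArg f (proj_ring_liftParticle hn p x)
  · rw [Finset.sum_congr rfl (g := fun _ => f (x.proj n hn)), Finset.sum_const, Finset.card_compl,
      Finset.card_map, Finset.card_univ]
    intro p hp
    rw [proj_ring_of_lt]
    by_contra hlt
    obtain ⟨p', rfl⟩ := exists_liftParticle hn p (not_lt.1 hlt)
    simp at hp

theorem GT.apply_le_apply_of_diagonal (x : GT N) {p q : Particle N} (h : (p.1 : ℕ) ≤ q.1)
    (hdiag : (q.2 : ℕ) + p.1 = p.2 + q.1) : x.1 p.1 p.2 ≤ x.1 q.1 q.2 := by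
  obtain ⟨⟨a, ha⟩, ⟨b, hb⟩⟩ := p
  obtain ⟨⟨c, hc⟩, ⟨d, hd⟩⟩ := q
  simp only at h hdiag hb hd ⊢
  obtain ⟨r, rfl⟩ := Nat.exists_eq_add_of_le h
  obtain rfl : d = b + r := by omega
  clear h hdiag
  induction r with
  | zero => exact le_rfl
  | succ r ih =>
    exact (ih (by omega) (by omega)).trans (x.2.2 ⟨a + r, by omega⟩ ⟨b + r, by simp only; omega⟩).2

theorem top_ring_eq_add_one_iff (p : Particle N) (x : GT N) (i : Fin N) :
    (ring p x).top i = x.top i + 1 ↔ ¬ Blocked x.1 p ∧ Carried x.1 p ⟨Fin.last N, i⟩ := by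
  simp only [GT.top, ring, ringArr]
  split_ifs with h <;> simp [h]

theorem carried_liftParticle_last_iff (p : Particle N) (x : GT (N + 1)) (j : Fin (N + 1)) :
    Carried x.1 (liftParticle N.le_succ p) ⟨Fin.last (N + 1), j⟩ ↔
      ∃ i : Fin N, i.succ = j ∧ x.init.top i = x.top j ∧ Carried x.init.1 p ⟨Fin.last N, i⟩ := by
  have hp := p.1.isLt
  constructor
  · rintro ⟨-, hdiag, hx⟩
    simp only [Fin.val_last, liftParticle] at hdiag
    obtain ⟨i, rfl⟩ : ∃ i : Fin N, i.succ = j :=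
      Fin.exists_succ_eq.2 fun hj => by simp only [hj, Fin.val_zero] at hdiag; omega
    have hdiag' : (i : ℕ) + p.1 = p.2 + (Fin.last N : Fin (N + 1)) := by
      simp only [Fin.val_succ, Fin.val_last] at hdiag ⊢
      omega
    have hle : (p.1 : ℕ) ≤ (Fin.last N : Fin (N + 1)) := by simp only [Fin.val_last]; omega
    -- `x.init.top i` lies between the values of `x` at `p` and at the top, which agree.
    have hlow : x.init.1 p.1 p.2 ≤ x.init.top i :=
      x.init.apply_le_apply_of_diagonal (q := ⟨Fin.last N, i⟩) hle hdiag'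
    have hhigh : x.init.top i ≤ x.top i.succ := (x.interlaces_top i).2
    have htop : x.top i.succ = x.init.1 p.1 p.2 := hx
    exact ⟨i, rfl, by omega, hle, hdiag', hlow.antisymm' (htop ▸ hhigh)⟩
  · rintro ⟨i, rfl, htop, -, hdiag, hx⟩
    refine ⟨?_, ?_, htop.symm.trans hx⟩
    · simp only [Fin.val_last, liftParticle]; omega
    · simp only [Fin.val_last, liftParticle, Fin.val_succ] at hdiag ⊢; omega

/-- The new top level when the top level was `y` and the level below has moved from `x` to `x'`. -/
def pushed (x x' : Fin N → ℤ) (y : Fin (N + 1) → ℤ) : Fin (N + 1) → ℤ := fun j =>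
  if ∃ i : Fin N, i.succ = j ∧ x i = y j ∧ x' i = x i + 1 then y j + 1 else y j

theorem pushed_self (x : Fin N → ℤ) (y : Fin (N + 1) → ℤ) : pushed x x y = y := by
  funext j
  simp [pushed]

theorem pushed_add_single (x : Fin N → ℤ) (y : Fin (N + 1) → ℤ) (i : Fin N) :
    pushed x (x + Pi.single i 1) y =
      if x i = y i.succ then y + Pi.single i.succ 1 else y := by
  have hmoves : ∀ j, (∃ i' : Fin N, i'.succ = j ∧ x i' = y j ∧
      (x + Pi.single i 1 : Fin N → ℤ) i' = x i' + 1) ↔ j = i.succ ∧ x i = y i.succ := by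
    intro j
    constructor
    · rintro ⟨i', rfl, hx, hi'⟩
      obtain rfl : i' = i := by
        by_contra hne
        simp [Pi.single_eq_of_ne hne] at hi'
      exact ⟨rfl, hx⟩
    · rintro ⟨rfl, hx⟩
      exact ⟨i, rfl, hx, by simp⟩
  funext j
  simp only [pushed, hmoves]
  split_ifs with hj hx hx <;> simp_all [Pi.single_apply]

theorem top_ring_liftParticle (p : Particle N) (x : GT (N + 1)) :
    (ring (liftParticle N.le_succ p) x).top =
      pushed x.init.top (ring p x.init).top x.top := by
  funext j
  refine if_congr ?_ rfl rfl
  simp only [blocked_liftParticle, carried_liftParticle_last_iff, top_ring_eq_add_one_iff]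
  tauto

/-- The `k`-th particle of the level `y` is blocked by the level `x` below. -/
def BlockedBy (x : Fin N → ℤ) (y : Fin (N + 1) → ℤ) (k : Fin (N + 1)) : Prop :=
  ∃ i : Fin N, i.castSucc = k ∧ y k + 1 = x i

/-- The new top level when the clock of its `k`-th particle rings, the top level was `y` and the
level below is `x`. -/
def jumped (x : Fin N → ℤ) (k : Fin (N + 1)) (y : Fin (N + 1) → ℤ) : Fin (N + 1) → ℤ :=
  if BlockedBy x y k then y else y + Pi.single k 1

theorem blocked_last_iff (k : Fin (N + 1)) (x : GT (N + 1)) :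
    Blocked x.1 ⟨Fin.last (N + 1), k⟩ ↔ BlockedBy x.init.top x.top k := by
  constructor
  · rintro ⟨⟨l, hl⟩, j, hlN, hj, hx⟩
    obtain rfl : l = N := by simpa using hlN
    exact ⟨j, Fin.ext hj, hx⟩
  · rintro ⟨i, rfl, hx⟩
    exact ⟨⟨N, by omega⟩, i, rfl, rfl, hx⟩

theorem top_ring_last (k : Fin (N + 1)) (x : GT (N + 1)) :
    (ring ⟨Fin.last (N + 1), k⟩ x).top = jumped x.init.top k x.top := by
  have hcarried : ∀ j, Carried x.1 ⟨Fin.last (N + 1), k⟩ ⟨Fin.last (N + 1), j⟩ ↔ j = k := by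
    refine fun j => ⟨fun h => Fin.ext ?_, ?_⟩
    · simpa using h.2.1
    · rintro rfl
      exact ⟨le_rfl, rfl, rfl⟩
  funext j
  change (if _ then x.top j + 1 else x.top j) = _
  simp only [jumped, blocked_last_iff, hcarried]
  by_cases hb : BlockedBy x.init.top x.top k
  · simp [hb]
  · rcases eq_or_ne j k with rfl | hj
    · simp [hb]
    · simp [hb, hj]

end Rings

/-! ### The intertwining of consecutive levels -/

section TwoLevels

variable {N : ℕ}

theorem interlaces_sub_single {x : Fin N → ℤ} {y : Fin (N + 1) → ℤ} (i : Fin N)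
    (h : ∀ j, j ≠ i → y j.castSucc < x j ∧ x j ≤ y j.succ) :
    Interlaces (x - Pi.single i 1) y ↔ y i.castSucc < x i - 1 ∧ x i - 1 ≤ y i.succ := by
  refine ⟨fun h' => by simpa using h' i, fun h' j => ?_⟩
  rcases eq_or_ne j i with rfl | hj
  · simpa using h'
  · simpa [Pi.single_eq_of_ne hj] using h j hj

theorem interlaces_of_interlaces_add_single_zero {x : Fin N → ℤ} {y : Fin (N + 1) → ℤ}
    (h : Interlaces x (y + Pi.single 0 1)) : Interlaces x y := by
  intro j
  have hj := h j
  simp only [Pi.add_apply, Pi.single_eq_of_ne (Fin.succ_ne_zero j), Pi.single_apply] at hj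
  split_ifs at hj <;> omega

theorem bounds_of_interlaces_add_single_succ {x : Fin N → ℤ} {y : Fin (N + 1) → ℤ} {i j : Fin N}
    (h : Interlaces x (y + Pi.single i.succ 1)) (hj : j ≠ i) :
    y j.castSucc < x j ∧ x j ≤ y j.succ := by
  have hj' := h j
  have hs : j.succ ≠ i.succ := fun h => hj (Fin.succ_injective _ h)
  simp only [Pi.add_apply, Pi.single_eq_of_ne hs, Pi.single_apply] at hj'
  split_ifs at hj' <;> omega

theorem not_blockedBy_of_interlaces_add_single {x : Fin N → ℤ} {y : Fin (N + 1) → ℤ}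
    {k : Fin (N + 1)} (h : Interlaces x (y + Pi.single k 1)) : ¬ BlockedBy x y k := by
  rintro ⟨j, rfl, hj⟩
  have hlt := (h j).1
  simp only [Pi.add_apply, Pi.single_eq_same] at hlt
  omega

theorem tsum_eq_tsum_sub_single (f : (Fin N → ℤ) → ℝ≥0∞) (i : Fin N) :
    ∑' x, f x = ∑' x : Fin N → ℤ, f (x - Pi.single i 1) :=
  ((Equiv.subRight (Pi.single i 1 : Fin N → ℤ)).tsum_eq f).symm

variable {g : (Fin N → ℤ) → (Fin (N + 1) → ℤ) → ℝ≥0∞}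
  (hg : ∀ x y, ¬ Interlaces x y → g x y = 0)
include hg

-- The configurations with `x i = y i.castSucc + 1` are not reached by a jump of `x i`.
theorem interlacingSum_jump_add_blocked (y : Fin (N + 1) → ℤ) (i : Fin N) :
    interlacingSum y (fun x => if x i = y i.succ then 0 else g (x + Pi.single i 1) y) +
      interlacingSum y (fun x => if y i.castSucc + 1 = x i then g x y else 0) = ∑' x, g x y := by
  unfold interlacingSum
  rw [tsum_eq_tsum_sub_single _ i, ← ENNReal.tsum_add]
  refine tsum_congr fun x => ?_
  beta_reduce
  rw [sub_add_cancel]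
  by_cases hI : Interlaces x y
  · have hi := hI i
    rw [interlaces_sub_single i fun j _ => hI j]
    simp only [Pi.sub_apply, Pi.single_eq_same, hI, if_true]
    split_ifs <;> first | omega | simp
  · simp [hg x y hI]

theorem interlacingSum_push_add_free {y : Fin (N + 1) → ℤ} (hy : StrictMono y) (i : Fin N) :
    interlacingSum y (fun x =>
        if x i = y i.succ then g (x + Pi.single i 1) (y + Pi.single i.succ 1) else 0) +
      interlacingSum y (fun x =>
        if BlockedBy x y i.succ then 0 else g x (y + Pi.single i.succ 1)) =
      ∑' x, g x (y + Pi.single i.succ 1) := by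
  unfold interlacingSum
  rw [tsum_eq_tsum_sub_single _ i, ← ENNReal.tsum_add]
  refine tsum_congr fun x => ?_
  beta_reduce
  rw [sub_add_cancel]
  by_cases hI : Interlaces x (y + Pi.single i.succ 1)
  · have hother : ∀ j, j ≠ i → y j.castSucc < x j ∧ x j ≤ y j.succ :=
      fun j => bounds_of_interlaces_add_single_succ hI
    have hi := hI i
    have hne : i.castSucc ≠ i.succ := Fin.castSucc_lt_succ.ne
    simp only [Pi.add_apply, Pi.single_eq_of_ne hne, Pi.single_eq_same] at hi
    have interlaces_iff : Interlaces x y ↔ x i ≤ y i.succ := by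
      refine ⟨fun h => (h i).2, fun h j => ?_⟩
      rcases eq_or_ne j i with rfl | hj
      exacts [⟨by omega, h⟩, hother j hj]
    have hlt : y i.castSucc < y i.succ := hy Fin.castSucc_lt_succ
    rw [interlaces_sub_single i hother, interlaces_iff,
      if_neg (not_blockedBy_of_interlaces_add_single hI)]
    simp only [Pi.sub_apply, Pi.single_eq_same]
    split_ifs <;> first | omega | simp
  · simp [hg x _ hI]

theorem interlacingSum_free_zero (y : Fin (N + 1) → ℤ) :
    interlacingSum y (fun x => if BlockedBy x y 0 then 0 else g x (y + Pi.single 0 1)) =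
      ∑' x, g x (y + Pi.single 0 1) := by
  refine tsum_congr fun x => ?_
  beta_reduce
  by_cases hI : Interlaces x (y + Pi.single 0 1)
  · rw [if_pos (interlaces_of_interlaces_add_single_zero hI),
      if_neg (not_blockedBy_of_interlaces_add_single hI)]
  · simp [hg x _ hI]

omit hg

theorem apply_add_single_pushed (x : Fin N → ℤ) (y : Fin (N + 1) → ℤ) (i : Fin N) :
    g (x + Pi.single i 1) (pushed x (x + Pi.single i 1) y) =
      (if x i = y i.succ then 0 else g (x + Pi.single i 1) y) +
        if x i = y i.succ then g (x + Pi.single i 1) (y + Pi.single i.succ 1) else 0 := by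
  rw [pushed_add_single]
  split_ifs <;> simp

theorem sum_apply_jumped (x : Fin N → ℤ) (y : Fin (N + 1) → ℤ) :
    ∑ k, g x (jumped x k y) = ∑ i : Fin N, (if y i.castSucc + 1 = x i then g x y else 0) +
      ∑ k, if BlockedBy x y k then 0 else g x (y + Pi.single k 1) := by
  have sum_blocked : ∑ k, (if BlockedBy x y k then g x y else 0) =
      ∑ i : Fin N, if y i.castSucc + 1 = x i then g x y else 0 := by
    have hlast : ¬ BlockedBy x y (Fin.last N) := fun ⟨j, hj, _⟩ => (Fin.castSucc_lt_last j).ne hj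
    have hcastSucc : ∀ i : Fin N, BlockedBy x y i.castSucc ↔ y i.castSucc + 1 = x i :=
      fun i => ⟨fun ⟨j, hj, h⟩ => Fin.castSucc_injective _ hj ▸ h, fun h => ⟨i, rfl, h⟩⟩
    rw [Fin.sum_univ_castSucc, if_neg hlast, add_zero]
    exact Finset.sum_congr rfl fun i _ => if_congr (hcastSucc i) rfl rfl
  rw [← sum_blocked, ← Finset.sum_add_distrib]
  refine Finset.sum_congr rfl fun k _ => ?_
  rw [jumped]
  split_ifs <;> simp

include hg in
theorem two_level_intertwining {y : Fin (N + 1) → ℤ} (hy : StrictMono y) (c : ℝ≥0∞) :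
    interlacingSum y (fun x =>
        c * g x y + ∑ i, g (x + Pi.single i 1) (pushed x (x + Pi.single i 1) y)) +
      interlacingSum y (fun x => ∑ k, g x (jumped x k y)) =
    (c + N) * ∑' x, g x y + ∑ k : Fin (N + 1), ∑' x, g x (y + Pi.single k 1) := by
  have hN : (N : ℝ≥0∞) * ∑' x, g x y = ∑ i : Fin N,
      (interlacingSum y (fun x => if x i = y i.succ then 0 else g (x + Pi.single i 1) y) +
        interlacingSum y fun x => if y i.castSucc + 1 = x i then g x y else 0) := by
    simp [interlacingSum_jump_add_blocked hg]
  rw [add_mul, hN,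
    Fin.sum_univ_succ fun k => ∑' x, g x (y + (Pi.single k 1 : Fin (N + 1) → ℤ)),
    ← interlacingSum_free_zero hg]
  simp only [apply_add_single_pushed, sum_apply_jumped]
  simp only [interlacingSum_add, interlacingSum_finsetSum, interlacingSum_const_mul,
    interlacingSum_eq_tsum fun x => hg x y, ← interlacingSum_push_add_free hg hy,
    Finset.sum_add_distrib, Fin.sum_univ_succ]
  ring

end TwoLevels

section Intertwining

variable {N : ℕ}

theorem init_ring_liftParticle (p : Particle N) (w : GT (N + 1)) :
    (ring (liftParticle N.le_succ p) w).init = ring p w.init :=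
  proj_ring_liftParticle N.le_succ p w

theorem init_ring_last (k : Fin (N + 1)) (w : GT (N + 1)) :
    (ring ⟨Fin.last (N + 1), k⟩ w).init = w.init :=
  proj_ring_of_lt N.le_succ N.lt_succ_self w

theorem apply_ring_liftParticle (f : GT (N + 1) → ℝ≥0∞) (p : Particle N) (w : GT (N + 1)) :
    f (ring (liftParticle N.le_succ p) w) =
      extendSnoc f (ring p w.init) (pushed w.init.top (ring p w.init).top w.top) := by
  rw [← extendSnoc_init_top f, init_ring_liftParticle, top_ring_liftParticle]

theorem apply_ring_last (f : GT (N + 1) → ℝ≥0∞) (k : Fin (N + 1)) (w : GT (N + 1)) :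
    f (ring ⟨Fin.last (N + 1), k⟩ w) = extendSnoc f w.init (jumped w.init.top k w.top) := by
  rw [← extendSnoc_init_top f, init_ring_last, top_ring_last]

theorem sum_fiberSum_top_ring_last (f : GT (N + 1) → ℝ≥0∞) (a : Fin (N + 1) → ℤ) :
    ∑ k : Fin (N + 1), fiberSum GT.top (fun w => f (ring ⟨Fin.last (N + 1), k⟩ w)) a =
      interlacingSum a fun x => ∑ k, topTwoSum f x (jumped x k a) := by
  rw [interlacingSum_finsetSum]
  refine Finset.sum_congr rfl fun k _ => ?_
  simp only [apply_ring_last]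
  rw [fiberSum_top_succ fun z y => extendSnoc f z (jumped z.top k y)]
  exact interlacingSum_congr fun x _ => fiberSum_congr fun z hz => by rw [hz]

theorem sum_fiberSum_top_ring_liftParticle {c : ℝ≥0∞}
    (ih : ∀ (F : GT N → ℝ≥0∞) {x : Fin N → ℤ}, StrictMono x →
      ∑ p : Particle N, fiberSum GT.top (fun z => F (ring p z)) x =
        c * fiberSum GT.top F x + ∑ i, fiberSum GT.top F (x + Pi.single i 1))
    (f : GT (N + 1) → ℝ≥0∞) (a : Fin (N + 1) → ℤ) :
    ∑ p : Particle N, fiberSum GT.top (fun w => f (ring (liftParticle N.le_succ p) w)) a =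
      interlacingSum a fun x => c * topTwoSum f x a +
        ∑ i, topTwoSum f (x + Pi.single i 1) (pushed x (x + Pi.single i 1) a) := by
  have fiberSum_ring : ∀ p : Particle N,
      fiberSum GT.top (fun w => f (ring (liftParticle N.le_succ p) w)) a =
        interlacingSum a (fiberSum GT.top fun z =>
          extendSnoc f (ring p z) (pushed z.top (ring p z).top a)) := fun p => by
    simp only [apply_ring_liftParticle]
    exact fiberSum_top_succ
      (fun z y => extendSnoc f (ring p z) (pushed z.top (ring p z).top y)) a
  simp only [fiberSum_ring, ← interlacingSum_finsetSum]
  refine interlacingSum_congr fun x hx => ?_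
  have fiberSum_pushed : ∀ x', fiberSum GT.top (fun z => extendSnoc f z (pushed x z.top a)) x' =
      topTwoSum f x' (pushed x x' a) := fun x' => fiberSum_congr fun z hz => by rw [hz]
  rw [Finset.sum_congr rfl fun p _ => fiberSum_congr fun z hz => by rw [hz],
    ih (fun z => extendSnoc f z (pushed x z.top a)) hx.strictMono_left]
  simp only [fiberSum_pushed, pushed_self]

theorem sum_fiberSum_top_ring (f : GT N → ℝ≥0∞) {a : Fin N → ℤ} (ha : StrictMono a) :
    ∑ p : Particle N, fiberSum GT.top (fun w => f (ring p w)) a =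
      (∑ j : Fin N, (j : ℕ) : ℕ) * fiberSum GT.top f a +
        ∑ i, fiberSum GT.top f (a + Pi.single i 1) := by
  induction N with
  | zero =>
    have : IsEmpty (Particle 0) := ⟨fun p => by have := p.1.isLt; have := p.2.isLt; omega⟩
    simp
  | succ N ih =>
    have split_particles : ∑ p : Particle (N + 1), fiberSum GT.top (fun w => f (ring p w)) a =
        ∑ p : Particle N, fiberSum GT.top (fun w => f (ring (liftParticle N.le_succ p) w)) a +
          ∑ k : Fin (N + 1), fiberSum GT.top (fun w => f (ring ⟨Fin.last (N + 1), k⟩ w)) a := by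
      rw [Fintype.sum_sigma, Fin.sum_univ_castSucc, Fintype.sum_sigma]
      rfl
    rw [split_particles, sum_fiberSum_top_ring_liftParticle ih, sum_fiberSum_top_ring_last,
      two_level_intertwining (fun _ _ => topTwoSum_of_not_interlaces f) ha,
      Fin.sum_univ_castSucc fun j : Fin (N + 1) => (j : ℕ)]
    simp [tsum_topTwoSum]

end Intertwining

/-! ### Exponential generating series -/

section ExpSum

/-- The exponential generating series `∑ t ^ r / r! * u r`. -/
def expSum (t : ℝ≥0) (u : ℕ → ℝ≥0∞) : ℝ≥0∞ :=
  ∑' r : ℕ, ENNReal.ofReal ((t : ℝ) ^ r / (r.factorial : ℝ)) * u r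

theorem expSum_natCast_pow (t : ℝ≥0) (c : ℕ) :
    expSum t (fun r => (c : ℝ≥0∞) ^ r) = ENNReal.ofReal (Real.exp (c * t)) := by
  have hterm : ∀ r : ℕ, ENNReal.ofReal ((t : ℝ) ^ r / (r.factorial : ℝ)) * (c : ℝ≥0∞) ^ r =
      ENNReal.ofReal ((c * t : ℝ) ^ r / (r.factorial : ℝ)) := fun r => by
    rw [← Nat.cast_pow, ← ENNReal.ofReal_natCast (c ^ r), ← ENNReal.ofReal_mul (by positivity)]
    push_cast
    ring_nf
  simp only [expSum, hterm]
  rw [← ENNReal.ofReal_tsum_of_nonneg (fun r => by positivity) (Real.summable_pow_div_factorial _),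
    Real.exp_eq_exp_ℝ, NormedSpace.exp_eq_tsum_div]

theorem fiberSum_expSum {α β : Type*} (f : α → β) (t : ℝ≥0) (u : ℕ → α → ℝ≥0∞) (b : β) :
    fiberSum f (fun a => expSum t fun r => u r a) b = expSum t fun r => fiberSum f (u r) b := by
  simp only [expSum, fiberSum_tsum, fiberSum_const_mul]

theorem tsum_sum_antidiagonal (F : ℕ × ℕ → ℝ≥0∞) :
    ∑' r : ℕ, ∑ m ∈ Finset.HasAntidiagonal.antidiagonal r, F m = ∑' m, F m := by
  simp only [← Finset.tsum_subtype (Finset.HasAntidiagonal.antidiagonal _) F]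
  rw [← ENNReal.tsum_sigma' fun p : (r : ℕ) × Finset.HasAntidiagonal.antidiagonal r => F p.2]
  exact Finset.HasAntidiagonal.sigmaAntidiagonalEquivProd.tsum_eq F

theorem pow_add_div_factorial_mul_choose (t : ℝ) (j k : ℕ) :
    t ^ (j + k) / ((j + k).factorial : ℝ) * ((j + k).choose j : ℝ) =
      t ^ j / (j.factorial : ℝ) * (t ^ k / (k.factorial : ℝ)) := by
  have hchoose : ((j + k).choose j : ℝ) * j.factorial * k.factorial = (j + k).factorial :=
    mod_cast Nat.choose_symm_add (a := j) ▸ Nat.add_choose_mul_factorial_mul_factorial j k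
  rw [← hchoose]
  have : ((j + k).choose j : ℝ) ≠ 0 := mod_cast (Nat.choose_pos (Nat.le_add_right j k)).ne'
  field_simp
  exact pow_add t j k

theorem expSum_mul_expSum (t : ℝ≥0) (u v : ℕ → ℝ≥0∞) :
    expSum t (fun r => ∑ m ∈ Finset.HasAntidiagonal.antidiagonal r,
      (r.choose m.1 : ℝ≥0∞) * (u m.1 * v m.2)) = expSum t u * expSum t v := by
  simp only [expSum, ← ENNReal.tsum_mul_left, ← ENNReal.tsum_mul_right, Finset.mul_sum]
  rw [ENNReal.tsum_comm, ← ENNReal.tsum_prod, ← tsum_sum_antidiagonal]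
  refine tsum_congr fun r => Finset.sum_congr rfl fun m hm => ?_
  obtain rfl := Finset.HasAntidiagonal.mem_antidiagonal.1 hm
  rw [← ENNReal.ofReal_natCast, ← mul_assoc, ← ENNReal.ofReal_mul (by positivity),
    pow_add_div_factorial_mul_choose, ENNReal.ofReal_mul (by positivity)]
  ring

theorem expSum_add_natCast_pow {α : Type*} (B : Module.End ℝ≥0∞ (α → ℝ≥0∞)) (c : ℕ)
    (t : ℝ≥0) (f : α → ℝ≥0∞) (a : α) :
    expSum t (fun r => ((B + (c : Module.End ℝ≥0∞ (α → ℝ≥0∞))) ^ r) f a) =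
      ENNReal.ofReal (Real.exp (c * t)) * expSum t (fun j => (B ^ j) f a) := by
  rw [mul_comm, ← expSum_natCast_pow, ← expSum_mul_expSum]
  congr 1
  funext r
  rw [(Nat.cast_commute c B).symm.add_pow', LinearMap.sum_apply, Finset.sum_apply]
  refine Finset.sum_congr rfl fun m _ => ?_
  rw [← Nat.cast_pow, ← Nat.cast_pow, (Nat.cast_commute _ _).symm.eq]
  simp only [Module.End.mul_apply, Module.End.natCast_apply, Pi.smul_apply, Pi.mul_apply,
    Pi.natCast_apply, nsmul_eq_mul]
  ring

end ExpSum

/-! ### Transition probabilities as exponential series -/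

section TransProb

variable {n N : ℕ}

/-- The operator `f ↦ ∑ p, f (ring p ·)`: the generator of the dynamics without its diagonal. -/
def ringOp (N : ℕ) : Module.End ℝ≥0∞ (GT N → ℝ≥0∞) :=
  ∑ p : Particle N, LinearMap.funLeft ℝ≥0∞ ℝ≥0∞ (ring p)

theorem ringOp_apply (f : GT N → ℝ≥0∞) (x : GT N) :
    ringOp N f x = ∑ p : Particle N, f (ring p x) := by
  simp [ringOp, LinearMap.funLeft_apply]

theorem ringOp_pow_succ_apply (r : ℕ) (f : GT N → ℝ≥0∞) (x : GT N) :
    (ringOp N ^ (r + 1)) f x = ∑ p : Particle N, (ringOp N ^ r) f (ring p x) := by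
  rw [pow_succ', Module.End.mul_apply, ringOp_apply]

theorem ringOp_pow_single (r : ℕ) (x y : GT N) :
    (ringOp N ^ r) (Pi.single y 1) x = ringCount r x y := by
  induction r generalizing x with
  | zero => simp [ringCount, Pi.single_apply]
  | succ r ih => simp [ringOp_pow_succ_apply, ringCount, ih]

theorem tsum_mul_ringCount (r : ℕ) (f : GT N → ℝ≥0∞) (x : GT N) :
    ∑' y, f y * ringCount r x y = (ringOp N ^ r) f x := by
  induction r generalizing x with
  | zero =>
    rw [tsum_eq_single x fun y hy => by simp [ringCount, hy.symm]]
    simp [ringCount]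
  | succ r ih =>
    simp only [ringOp_pow_succ_apply, ringCount, Nat.cast_sum, Finset.mul_sum, ← ih]
    rw [Summable.tsum_finsetSum fun _ _ => ENNReal.summable]

theorem ringCount_le (r : ℕ) (x y : GT N) : ringCount r x y ≤ Fintype.card (Particle N) ^ r := by
  induction r generalizing x with
  | zero =>
    unfold ringCount
    split_ifs <;> simp
  | succ r ih =>
    rw [ringCount, pow_succ']
    simpa using Finset.sum_le_sum fun p (_ : p ∈ Finset.univ) => ih (ring p x)

theorem ofReal_transProb (t : ℝ≥0) (x y : GT N) :
    ENNReal.ofReal (transProb t x y) =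
      ENNReal.ofReal (Real.exp (-((Fintype.card (Particle N) : ℝ) * t))) *
        expSum t (fun r => ringCount r x y) := by
  have hsummable : Summable fun r : ℕ =>
      (t : ℝ) ^ r / (r.factorial : ℝ) * (ringCount r x y : ℝ) := by
    refine Summable.of_nonneg_of_le (fun r => by positivity) (fun r => ?_)
      (Real.summable_pow_div_factorial ((t : ℝ) * (Fintype.card (Particle N) : ℝ)))
    rw [mul_pow, mul_div_right_comm]
    gcongr
    exact mod_cast ringCount_le r x y
  rw [transProb, ENNReal.ofReal_mul (by positivity),
    ENNReal.ofReal_tsum_of_nonneg (fun r => by positivity) hsummable, expSum]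
  congr 1
  refine tsum_congr fun r => ?_
  rw [ENNReal.ofReal_mul (by positivity), ENNReal.ofReal_natCast]

theorem tsum_mul_transProb (t : ℝ≥0) (f : GT N → ℝ≥0∞) (x : GT N) :
    ∑' y, f y * ENNReal.ofReal (transProb t x y) =
      ENNReal.ofReal (Real.exp (-((Fintype.card (Particle N) : ℝ) * t))) *
        expSum t (fun r => (ringOp N ^ r) f x) := by
  simp only [ofReal_transProb, expSum, ← tsum_mul_ringCount, ← ENNReal.tsum_mul_left]
  rw [ENNReal.tsum_comm]
  exact tsum_congr fun r => tsum_congr fun y => by ring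

theorem ringOp_pow_comp_proj (hn : n ≤ N) (r : ℕ) (f : GT n → ℝ≥0∞) (x : GT N) :
    (ringOp N ^ r) (fun z => f (z.proj n hn)) x =
      ((ringOp n + ((Fintype.card (Particle N) - Fintype.card (Particle n) : ℕ) :
        Module.End ℝ≥0∞ (GT n → ℝ≥0∞))) ^ r) f (x.proj n hn) := by
  induction r generalizing x with
  | zero => rfl
  | succ r ih =>
    simp only [ringOp_pow_succ_apply, ih]
    rw [pow_succ', Module.End.mul_apply, sum_proj_ring hn, LinearMap.add_apply,
      Module.End.natCast_apply, Pi.add_apply, ringOp_apply, Pi.smul_apply]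

theorem fiberSum_proj_transProb (hn : n ≤ N) (t : ℝ≥0) (x : GT N) (z : GT n) :
    fiberSum (fun y : GT N => y.proj n hn) (fun y => ENNReal.ofReal (transProb t x y)) z =
      ENNReal.ofReal (transProb t (x.proj n hn) z) := by
  have hsum := tsum_mul_transProb t
    (fun y : GT N => (Pi.single z 1 : GT n → ℝ≥0∞) (y.proj n hn)) x
  simp only [ringOp_pow_comp_proj, expSum_add_natCast_pow, ringOp_pow_single] at hsum
  simp only [Pi.single_apply, ite_mul, one_mul, zero_mul] at hsum
  rw [fiberSum, hsum, ofReal_transProb, ← mul_assoc, ← ENNReal.ofReal_mul (by positivity),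
    ← Real.exp_add, Nat.cast_sub (card_particle_le hn)]
  congr 3
  ring

end TransProb

/-! ### Transition probabilities summed over the lower levels -/

section Killed

variable {N : ℕ}

/-- The operator `g ↦ ∑ i, g (· + e_i)`, restricted to the Weyl chamber: the generator, without its
diagonal, of independent particles that are killed when two of them collide. -/
def killedOp (N : ℕ) : Module.End ℝ≥0∞ ((Fin N → ℤ) → ℝ≥0∞) where
  toFun g a := if StrictMono a then ∑ i, g (a + Pi.single i 1) else 0
  map_add' f g := by
    funext a
    simp only [Pi.add_apply]
    split_ifs <;> simp [Finset.sum_add_distrib]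
  map_smul' c f := by
    funext a
    simp only [Pi.smul_apply, RingHom.id_apply, smul_eq_mul]
    split_ifs <;> simp [Finset.mul_sum]

theorem killedOp_apply (g : (Fin N → ℤ) → ℝ≥0∞) (a : Fin N → ℤ) :
    killedOp N g a = if StrictMono a then ∑ i, g (a + Pi.single i 1) else 0 :=
  rfl

theorem killedOp_pow_single (r : ℕ) (a b : Fin N → ℤ) :
    (killedOp N ^ r) (Pi.single b 1) a = nonCollidingPathCount r a b := by
  induction r generalizing a with
  | zero => simp [nonCollidingPathCount, Pi.single_apply]
  | succ r ih =>
    rw [pow_succ', Module.End.mul_apply, killedOp_apply, nonCollidingPathCount]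
    split_ifs <;> simp [ih]

theorem expSum_nonCollidingPathCount (t : ℝ≥0) {a b : Fin N → ℤ} (ha : StrictMono a)
    (hb : StrictMono b) :
    expSum t (fun r => nonCollidingPathCount r a b) =
      ENNReal.ofReal ((t : ℝ) ^ (∑ i, b i - ∑ i, a i).toNat * invFactDet a b) := by
  simp only [expSum, ← ENNReal.ofReal_natCast, nonCollidingPathCount_eq _ (Or.inl ha) hb]
  rcases lt_or_ge (∑ i, b i) (∑ i, a i) with h | h
  · simp [invFactDet_of_sum_lt ha hb h]
  · rw [tsum_eq_single (∑ i, b i - ∑ i, a i).toNat, if_pos (by omega),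
      ← ENNReal.ofReal_mul (by positivity)]
    · congr 1
      field_simp
    · intro r hr
      rw [if_neg (by omega)]
      simp

theorem fiberSum_top_of_not_strictMono (f : GT N → ℝ≥0∞) {a : Fin N → ℤ}
    (ha : ¬ StrictMono a) : fiberSum GT.top f a = 0 :=
  fiberSum_eq_zero fun w hw => absurd (hw ▸ w.strictMono_top) ha

theorem fiberSum_top_ringOp (f : GT N → ℝ≥0∞) :
    fiberSum GT.top (ringOp N f) =
      (killedOp N + ((∑ j : Fin N, (j : ℕ) : ℕ) : Module.End ℝ≥0∞ ((Fin N → ℤ) → ℝ≥0∞)))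
        (fiberSum GT.top f) := by
  funext a
  rw [LinearMap.add_apply, Module.End.natCast_apply, Pi.add_apply, Pi.smul_apply, nsmul_eq_mul,
    killedOp_apply]
  split_ifs with ha
  · rw [add_comm, ← sum_fiberSum_top_ring f ha, ← fiberSum_finsetSum]
    exact fiberSum_congr fun w _ => ringOp_apply f w
  · simp [fiberSum_top_of_not_strictMono _ ha]

theorem fiberSum_top_ringOp_pow (r : ℕ) (f : GT N → ℝ≥0∞) :
    fiberSum GT.top ((ringOp N ^ r) f) =
      ((killedOp N + ((∑ j : Fin N, (j : ℕ) : ℕ) :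
        Module.End ℝ≥0∞ ((Fin N → ℤ) → ℝ≥0∞))) ^ r) (fiberSum GT.top f) := by
  induction r with
  | zero => rfl
  | succ r ih =>
    rw [pow_succ', pow_succ', Module.End.mul_apply, Module.End.mul_apply, fiberSum_top_ringOp, ih]

theorem fiberSum_top_transProb (t : ℝ≥0) {a : Fin N → ℤ} (ha : StrictMono a) (z : GT N) :
    fiberSum GT.top (fun w => ENNReal.ofReal (transProb t w z)) a =
      ENNReal.ofReal (poissonDet t a z.top) := by
  simp only [ofReal_transProb, fiberSum_const_mul, fiberSum_expSum, ← ringOp_pow_single]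
  simp only [fiberSum_top_ringOp_pow, fiberSum_single, expSum_add_natCast_pow, killedOp_pow_single]
  rw [expSum_nonCollidingPathCount t ha z.strictMono_top, poissonDet_eq,
    ENNReal.ofReal_mul (p := Real.exp _) (by positivity), ← mul_assoc,
    ← ENNReal.ofReal_mul (by positivity), ← Real.exp_add, card_particle]
  congr 3
  push_cast
  ring

end Killed

/-! ### Markov property -/

section Markov

instance (n : ℕ) : Countable (Weyl n) :=
  inferInstanceAs (Countable {x : Fin n → ℤ // StrictMono x})

instance (N : ℕ) : Countable (GT N) :=
  inferInstanceAs (Countable {x : Arr N // IsGT x})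

theorem measurableSet_setOf_comp {Ω β : Type*} [MeasurableSpace Ω] [Countable β] {Y : Ω → β}
    (hY : ∀ b, MeasurableSet {ω | Y ω = b}) (P : β → Prop) : MeasurableSet {ω | P (Y ω)} := by
  change MeasurableSet (Y ⁻¹' {b | P b})
  rw [← Set.biUnion_preimage_singleton]
  exact MeasurableSet.biUnion (Set.to_countable _) fun b _ => hY b

theorem measure_inter_comp_eq_tsum {Ω β : Type*} [MeasurableSpace Ω] [Countable β] (μ : Measure Ω)
    {Y : Ω → β} (hY : ∀ b, MeasurableSet {ω | Y ω = b}) (E : Set Ω) (P : β → Prop) :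
    μ (E ∩ {ω | P (Y ω)}) = ∑' b, if P b then μ (E ∩ {ω | Y ω = b}) else 0 := by
  have hsum := tsum_measure_preimage_singleton (μ := μ.restrict E) (Set.to_countable {b | P b})
    fun b _ => hY b
  rw [tsum_subtype {b | P b} fun b => μ.restrict E (Y ⁻¹' {b})] at hsum
  rw [Set.inter_comm, ← Measure.restrict_apply (measurableSet_setOf_comp hY P)]
  refine hsum.symm.trans (tsum_congr fun b => ?_)
  rw [Set.indicator_apply, Set.inter_comm E, ← Measure.restrict_apply (hY b)]
  rfl

theorem measure_eq_tsum_inter {Ω β : Type*} [MeasurableSpace Ω] [Countable β] (μ : Measure Ω)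
    {Y : Ω → β} (hY : ∀ b, MeasurableSet {ω | Y ω = b}) (E : Set Ω) :
    μ E = ∑' b, μ (E ∩ {ω | Y ω = b}) := by
  simpa using measure_inter_comp_eq_tsum μ hY E fun _ => True

variable {Ω : Type*} {N : ℕ} {X : ℝ≥0 → Ω → GT N} {E : Set Ω} {t t' : ℝ≥0}

theorem monotone_snoc {α : Type*} [Preorder α] {r : ℕ} {s : Fin (r + 1) → α} (hs : Monotone s)
    {a : α} (ha : s (Fin.last r) ≤ a) : Monotone (Fin.snoc s a : Fin (r + 2) → α) := by
  refine Fin.monotone_iff_le_succ.2 fun i => ?_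
  induction i using Fin.lastCases with
  | last => simpa using ha
  | cast i =>
    rw [Fin.succ_castSucc, Fin.snoc_castSucc (α := fun _ => α), Fin.snoc_castSucc (α := fun _ => α)]
    exact hs Fin.castSucc_lt_succ.le

/-- The event `E` depends on the values of `X` at finitely many times up to `t`, one of which
is `t`. -/
def PastEvent (X : ℝ≥0 → Ω → GT N) (E : Set Ω) (t : ℝ≥0) : Prop :=
  ∃ (r : ℕ) (s : Fin (r + 1) → ℝ≥0) (A : Set (Fin (r + 1) → GT N)),
    Monotone s ∧ s (Fin.last r) = t ∧ E = {ω | (fun i => X (s i) ω) ∈ A}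

theorem pastEvent_univ (X : ℝ≥0 → Ω → GT N) (t : ℝ≥0) : PastEvent X Set.univ t :=
  ⟨0, fun _ => t, Set.univ, monotone_const, rfl, by simp⟩

theorem PastEvent.inter (hE : PastEvent X E t) (h : t ≤ t') (B : GT N → Prop) :
    PastEvent X (E ∩ {ω | B (X t' ω)}) t' := by
  obtain ⟨r, s, A, hs, rfl, rfl⟩ := hE
  refine ⟨r + 1, Fin.snoc s t',
    {u | (fun i : Fin (r + 1) => u i.castSucc) ∈ A ∧ B (u (Fin.last _))},
    monotone_snoc hs h, Fin.snoc_last (α := fun _ => ℝ≥0) _ _, ?_⟩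
  ext ω
  simp only [Set.mem_ofPred_eq, Set.mem_inter_iff, Fin.snoc_castSucc, Fin.snoc_last]

theorem inter_forall_fin_succ' {c : ℕ} (E : Set Ω) (Q : Fin (c + 1) → Ω → Prop) :
    E ∩ {ω | ∀ a, Q a ω} =
      E ∩ {ω | ∀ a : Fin c, Q a.castSucc ω} ∩ {ω | Q (Fin.last c) ω} := by
  ext ω
  simp only [Set.mem_ofPred_eq, Set.mem_inter_iff, Fin.forall_fin_succ', and_assoc]

theorem PastEvent.inter_forall {c : ℕ} {τ : Fin (c + 1) → ℝ≥0} (hτ : Monotone τ)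
    (hE : PastEvent X E (τ 0)) (B : Fin c → GT N → Prop) :
    PastEvent X (E ∩ {ω | ∀ a, B a (X (τ a.succ) ω)}) (τ (Fin.last c)) := by
  induction c with
  | zero => simpa using hE
  | succ c ih =>
    rw [inter_forall_fin_succ']
    exact (ih (hτ.comp Fin.strictMono_castSucc.monotone) hE fun a => B a.castSucc).inter
      (hτ Fin.castSucc_lt_succ.le) (B (Fin.last c))

variable [MeasurableSpace Ω] {μ : Measure Ω}

theorem transProb_nonneg (t : ℝ≥0) (x y : GT N) : 0 ≤ transProb t x y :=
  mul_nonneg (Real.exp_pos _).le (tsum_nonneg fun r => by positivity)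

theorem IsPackedDynamics.measure_path [IsFiniteMeasure μ] (hX : IsPackedDynamics μ X) {r : ℕ}
    {s : Fin (r + 1) → ℝ≥0} (hs : Monotone s) (x : Fin (r + 1) → GT N) :
    μ {ω | ∀ i, X (s i) ω = x i} = μ {ω | X (s 0) ω = x 0} * ∏ i : Fin r,
      ENNReal.ofReal (transProb (s i.succ - s i.castSucc) (x i.castSucc) (x i.succ)) := by
  rw [← ENNReal.ofReal_prod_of_nonneg fun i _ => transProb_nonneg _ _ _, ← ofReal_measureReal,
    ← ofReal_measureReal, ← ENNReal.ofReal_mul measureReal_nonneg, hX.markov r s hs x]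

theorem IsPackedDynamics.measure_path_inter [IsFiniteMeasure μ] (hX : IsPackedDynamics μ X)
    {r : ℕ} {s : Fin (r + 1) → ℝ≥0} (hs : Monotone s) (ht : s (Fin.last r) ≤ t)
    (x : Fin (r + 1) → GT N) (z : GT N) :
    μ ({ω | ∀ i, X (s i) ω = x i} ∩ {ω | X t ω = z}) = μ {ω | ∀ i, X (s i) ω = x i} *
      ENNReal.ofReal (transProb (t - s (Fin.last r)) (x (Fin.last r)) z) := by
  have hpath := hX.measure_path (monotone_snoc hs ht) (Fin.snoc x z : Fin (r + 2) → GT N)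
  have hzero : (0 : Fin (r + 2)) = (0 : Fin (r + 1)).castSucc := rfl
  rw [Fin.prod_univ_castSucc] at hpath
  simp only [Fin.forall_fin_succ', Fin.succ_castSucc, Fin.succ_last, hzero, Fin.snoc_castSucc,
    Fin.snoc_last] at hpath
  rw [hX.measure_path hs x, mul_assoc, ← hpath]
  congr 1
  ext ω
  simp only [Set.mem_inter_iff, Set.mem_ofPred_eq, Fin.forall_fin_succ']

theorem PastEvent.measure_inter [IsFiniteMeasure μ] (hX : IsPackedDynamics μ X)
    (hE : PastEvent X E t) (h : t ≤ t') (w z : GT N) :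
    μ (E ∩ {ω | X t' ω = z} ∩ {ω | X t ω = w}) =
      μ (E ∩ {ω | X t ω = w}) * ENNReal.ofReal (transProb (t' - t) w z) := by
  obtain ⟨r, s, A, hs, rfl, rfl⟩ := hE
  have hpath : ∀ x : Fin (r + 1) → GT N, {ω | (fun i => X (s i) ω) = x} =
      {ω | ∀ i, X (s i) ω = x i} := fun x => Set.ext fun ω => funext_iff
  have hmeas : ∀ x : Fin (r + 1) → GT N, MeasurableSet {ω | (fun i => X (s i) ω) = x} := fun x => by
    rw [hpath, Set.ofPred_forall]
    exact MeasurableSet.iInter fun i => hX.measurable _ _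
  have hsum := fun F : Set Ω =>
    measure_inter_comp_eq_tsum μ hmeas F fun x => x ∈ A ∧ x (Fin.last r) = w
  rw [Set.inter_right_comm, Set.inter_comm]
  refine (hsum {ω | X t' ω = z}).trans (Eq.trans ?_
    (congrArg (· * _) ((Set.univ_inter _).symm ▸ hsum Set.univ).symm))
  rw [← ENNReal.tsum_mul_right]
  refine tsum_congr fun x => ?_
  split_ifs with hx
  · rw [Set.univ_inter, Set.inter_comm, hpath, hX.measure_path_inter hs h, hx.2]
  · rw [zero_mul]

end Markov

/-! ### Laws that depend on the top level only -/

section LevelLaw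

variable {Ω : Type*} [MeasurableSpace Ω] {μ : Measure Ω} {n N : ℕ} {X : ℝ≥0 → Ω → GT N} {E : Set Ω}
  {t t' : ℝ≥0}

/-- On the event `E`, the law of the lower `n` levels at time `t` has a density that depends on
level `n` only, and this density is `k`. -/
def HasLevelLaw (μ : Measure Ω) (X : ℝ≥0 → Ω → GT N) (hn : n ≤ N) (t : ℝ≥0) (E : Set Ω)
    (k : Weyl n → ℝ≥0∞) : Prop :=
  ∀ z : GT n, μ (E ∩ {ω | (X t ω).proj n hn = z}) = k (z.level n le_rfl)

/-- The density `k` on level `n` after a further time `t`. -/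
def evolve (t : ℝ≥0) (k : Weyl n → ℝ≥0∞) (y : Weyl n) : ℝ≥0∞ :=
  ∑' x : Weyl n, k x * ENNReal.ofReal (poissonDet t x y)

/-- The density on level `n`, if the one on level `n + 1` is `k`. -/
def lower (k : Weyl (n + 1) → ℝ≥0∞) (x : Weyl n) : ℝ≥0∞ :=
  ∑' y : Weyl (n + 1), if Interlaces x y then k y else 0

theorem fiberSum_level (f : GT n → ℝ≥0∞) (x : Weyl n) :
    fiberSum (fun w : GT n => w.level n le_rfl) f x = fiberSum GT.top f x :=
  tsum_congr fun w => by
    have : w.level n le_rfl = x ↔ w.top = x.1 := Subtype.ext_iff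
    simp only [this]
    congr

theorem fiberSum_init (k : Weyl (n + 1) → ℝ≥0∞) (z : GT n) :
    fiberSum GT.init (fun w => k (w.level (n + 1) le_rfl)) z = lower k (z.level n le_rfl) := by
  unfold fiberSum lower
  rw [← tsum_fiberSum (fun w : GT (n + 1) => w.level (n + 1) le_rfl)
    fun y w => if w.init = z then k y else 0]
  refine tsum_congr fun y => ?_
  have hlevel : ∀ w : GT (n + 1), w.level (n + 1) le_rfl = y ↔ w.top = y.1 :=
    fun w => Subtype.ext_iff
  split_ifs with h
  · rw [fiberSum, tsum_eq_single (z.snoc y h), if_pos ((hlevel _).2 (z.top_snoc y h)),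
      if_pos (z.init_snoc y h)]
    intro w hw
    rw [ite_eq_right_iff, ite_eq_right_iff]
    intro htop hinit
    exact absurd (GT.ext_init_top (hinit.trans (z.init_snoc y h).symm)
      (((hlevel w).1 htop).trans (z.top_snoc y h).symm)) hw
  · refine fiberSum_eq_zero fun w hw => if_neg fun hinit => h ?_
    rw [← hinit, ← hw]
    exact w.interlaces_top

theorem HasLevelLaw.evolve [IsFiniteMeasure μ] (hX : IsPackedDynamics μ X) {hn : n ≤ N}
    {k : Weyl n → ℝ≥0∞} (hk : HasLevelLaw μ X hn t E k) (hE : PastEvent X E t) (h : t ≤ t') :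
    HasLevelLaw μ X hn t' E (evolve (t' - t) k) := by
  intro z
  have hproj : ∀ (s : ℝ≥0) (v : GT n), μ (E ∩ {ω | (X s ω).proj n hn = v}) =
      fiberSum (fun w : GT N => w.proj n hn) (fun w => μ (E ∩ {ω | X s ω = w})) v :=
    fun s v => measure_inter_comp_eq_tsum μ (hX.measurable s) E fun w => w.proj n hn = v
  have hmarkov : ∀ w' : GT N, μ (E ∩ {ω | X t' ω = w'}) =
      ∑' w : GT N, μ (E ∩ {ω | X t ω = w}) * ENNReal.ofReal (transProb (t' - t) w w') := by
    intro w'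
    rw [measure_eq_tsum_inter μ (hX.measurable t)]
    exact tsum_congr fun w => hE.measure_inter hX h w w'
  calc μ (E ∩ {ω | (X t' ω).proj n hn = z})
      = ∑' w : GT N, μ (E ∩ {ω | X t ω = w}) *
          ENNReal.ofReal (transProb (t' - t) (w.proj n hn) z) := by
        simp only [hproj, hmarkov, fiberSum_tsum, fiberSum_const_mul, fiberSum_proj_transProb]
    _ = ∑' v : GT n, ENNReal.ofReal (transProb (t' - t) v z) * k (v.level n le_rfl) := by
        simp only [← hk _, hproj, ← fiberSum_const_mul]
        rw [tsum_fiberSum (fun w : GT N => w.proj n hn) fun v w =>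
          ENNReal.ofReal (transProb (t' - t) v z) * μ (E ∩ {ω | X t ω = w})]
        simp only [mul_comm]
    _ = ∑' x : Weyl n, k x * ENNReal.ofReal (poissonDet (t' - t) x z.top) := by
        rw [← tsum_congr fun x : Weyl n =>
          congrArg (k x * ·) (fiberSum_top_transProb (t' - t) x.2 z)]
        simp only [← fiberSum_level, ← fiberSum_const_mul]
        rw [tsum_fiberSum (fun v : GT n => v.level n le_rfl) fun x v =>
          k x * ENNReal.ofReal (transProb (t' - t) v z)]
        simp only [mul_comm]

theorem HasLevelLaw.observe {hn : n ≤ N} {k : Weyl n → ℝ≥0∞} (hk : HasLevelLaw μ X hn t E k)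
    (P : Weyl n → Prop) :
    HasLevelLaw μ X hn t (E ∩ {ω | P ((X t ω).level n hn)}) fun x => if P x then k x else 0 := by
  intro z
  have hevent : E ∩ {ω | P ((X t ω).level n hn)} ∩ {ω | (X t ω).proj n hn = z} =
      {_ω | P (z.level n le_rfl)} ∩ (E ∩ {ω | (X t ω).proj n hn = z}) := by
    ext ω
    constructor
    · rintro ⟨⟨hω, hP⟩, rfl⟩
      exact ⟨hP, hω, rfl⟩
    · rintro ⟨hP, hω, rfl⟩
      exact ⟨⟨hω, hP⟩, rfl⟩
  beta_reduce
  rw [hevent, ← hk z]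
  by_cases hP : P (z.level n le_rfl) <;> simp [hP]

theorem HasLevelLaw.lower (hX : IsPackedDynamics μ X) {hn : n + 1 ≤ N} {k : Weyl (n + 1) → ℝ≥0∞}
    (hk : HasLevelLaw μ X hn t E k) : HasLevelLaw μ X (n.le_succ.trans hn) t E (lower k) := by
  intro z
  rw [← fiberSum_init]
  simp only [← hk _]
  exact measure_inter_comp_eq_tsum μ
    (fun w => measurableSet_setOf_comp (hX.measurable t) fun x => x.proj (n + 1) hn = w) E
    fun w => w.init = z

theorem top_packed : (packed n).top = fun i : Fin n => -(n : ℤ) + (i : ℕ) := by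
  funext i
  change -(n : ℤ) - 1 + ((i : ℕ) + 1) = _
  ring

theorem eq_packed_of_top_eq (z : GT n) (h : z.top = (packed n).top) : z = packed n := by
  induction n with
  | zero => exact GT.ext_apply fun j k => absurd k.isLt (by omega)
  | succ n ih =>
    refine GT.ext_init_top (ih _ ?_) h
    funext k
    have hk := z.interlaces_top k
    rw [h, top_packed] at hk
    rw [top_packed]
    simp only [Fin.val_castSucc, Fin.val_succ] at hk ⊢
    omega

theorem IsPackedDynamics.hasLevelLaw_zero [IsProbabilityMeasure μ] (hX : IsPackedDynamics μ X)
    (hn : n ≤ N) :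
    HasLevelLaw μ X hn 0 Set.univ fun x => if x = (packed n).level n le_rfl then 1 else 0 := by
  intro z
  have hlevel : z.level n le_rfl = (packed n).level n le_rfl ↔ z = packed n :=
    ⟨fun h => eq_packed_of_top_eq z (congrArg Subtype.val h), fun h => h ▸ rfl⟩
  have hproj : ∀ᵐ ω ∂μ, (X 0 ω).proj n hn = packed n := hX.initial.mono fun ω hω => hω ▸ rfl
  rw [Set.univ_inter]
  simp only [hlevel]
  split_ifs with hz
  · rw [hz]
    exact (measure_congr (Filter.eventuallyEq_univ.2 hproj)).trans measure_univ
  · exact measure_mono_null (fun ω hω h => hz (hω.symm.trans h)) (ae_iff.1 hproj)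

theorem IsPackedDynamics.hasLevelLaw [IsProbabilityMeasure μ] (hX : IsPackedDynamics μ X)
    (hn : n ≤ N) (t : ℝ≥0) :
    HasLevelLaw μ X hn t Set.univ fun x => ENNReal.ofReal (poissonDet t (packed n).top x) := by
  convert (hX.hasLevelLaw_zero hn).evolve hX (pastEvent_univ X 0) (zero_le (a := t)) using 2 with x
  rw [evolve, tsum_eq_single ((packed n).level n le_rfl) fun y hy => by rw [if_neg hy, zero_mul],
    if_pos rfl, one_mul, tsub_zero]
  rfl

end LevelLaw

/-! ### Sums over paths and configurations -/

section Snoc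

variable {β : ℕ → Type*} {L : ℕ}

theorem tsum_snoc (F : (∀ n : Fin (L + 1), β n) → ℝ≥0∞) :
    ∑' z, F z = ∑' (z : ∀ n : Fin L, β n) (u : β L),
      F (Fin.snoc (α := fun n : Fin (L + 1) => β n) z u) := by
  rw [← (Fin.snocEquiv fun n : Fin (L + 1) => β n).tsum_eq, ENNReal.tsum_prod', ENNReal.tsum_comm]
  rfl

variable (z : ∀ n : Fin (L + 1), β n) (u : β (L + 1))

theorem prod_snoc {M : Type*} [CommMonoid M] (F : ∀ n, β n → β (n + 1) → M) :
    ∏ l : Fin (L + 1), F l (Fin.snoc (α := fun n : Fin (L + 2) => β n) z u l.castSucc)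
        (Fin.snoc (α := fun n : Fin (L + 2) => β n) z u l.succ) =
      (∏ l : Fin L, F l (z l.castSucc) (z l.succ)) * F L (z (Fin.last L)) u := by
  have hcast := Fin.snoc_castSucc (α := fun n : Fin (L + 2) => β n) u z
  have hlast := Fin.snoc_last (α := fun n : Fin (L + 2) => β n) u z
  rw [Fin.prod_univ_castSucc]
  exact congrArg₂ (· * ·)
    (Finset.prod_congr rfl fun l _ => congrArg₂ (F l) (hcast l.castSucc) (hcast l.succ))
    (congrArg₂ (F L) (hcast (Fin.last L)) hlast)

theorem forall_snoc (R : ∀ n, β n → Prop) :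
    (∀ l : Fin (L + 1), R (l + 1) (Fin.snoc (α := fun n : Fin (L + 2) => β n) z u l.succ)) ↔
      (∀ l : Fin L, R (l + 1) (z l.succ)) ∧ R (L + 1) u := by
  have hcast := Fin.snoc_castSucc (α := fun n : Fin (L + 2) => β n) u z
  have hlast := Fin.snoc_last (α := fun n : Fin (L + 2) => β n) u z
  rw [Fin.forall_fin_succ']
  exact and_congr (forall_congr' fun l => Iff.of_eq (congrArg (R (l + 1)) (hcast l.succ)))
    (Iff.of_eq (congrArg (R (L + 1)) hlast))

end Snoc

theorem fiberSum_last {α : Type*} {c : ℕ} (F : (Fin (c + 1) → α) → ℝ≥0∞) (x : α) :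
    fiberSum (fun u : Fin (c + 1) → α => u (Fin.last c)) F x =
      ∑' u : Fin c → α, F (Fin.snoc u x) := by
  rw [fiberSum, tsum_snoc (β := fun _ => α)]
  refine tsum_congr fun u => ?_
  simp only [Fin.snoc_last]
  exact tsum_ite_eq x _

section Configurations

variable {Ω : Type*} [MeasurableSpace Ω] {μ : Measure Ω} {n N : ℕ} {X : ℝ≥0 → Ω → GT N} {E : Set Ω}

/-- The transition density `∏_a det [p_{τ_a - τ_{a-1}}(u_{a-1}, u_a)]` along the values `u` of one
level at the times `τ`. -/
def pathDensity {c : ℕ} (τ : Fin (c + 1) → ℝ≥0) (u : Fin (c + 1) → Weyl n) : ℝ :=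
  ∏ a : Fin c, poissonDet (τ a.succ - τ a.castSucc) (u a.castSucc) (u a.succ)

/-- The factor that level `n + 1` contributes to the weight of a configuration: the transition from
level `n` at its first time to level `n + 1` at its last time, and the time steps on level
`n + 1`. -/
def levelFactor {c : ℕ → ℕ} (T : ∀ n, Fin (c n + 1) → ℝ≥0) (n : ℕ) (x : Fin (c n + 1) → Weyl n)
    (y : Fin (c (n + 1) + 1) → Weyl (n + 1)) : ℝ :=
  (if Interlaces (x 0) (y (Fin.last _)) then 1 else 0) * pathDensity (T (n + 1)) y

theorem pathDensity_nonneg {c : ℕ} (τ : Fin (c + 1) → ℝ≥0) (u : Fin (c + 1) → Weyl n) :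
    0 ≤ pathDensity τ u :=
  Finset.prod_nonneg fun a _ => poissonDet_nonneg _ (u a.castSucc).2 (u a.succ).2

theorem levelFactor_nonneg {c : ℕ → ℕ} (T : ∀ n, Fin (c n + 1) → ℝ≥0)
    (x : Fin (c n + 1) → Weyl n) (y : Fin (c (n + 1) + 1) → Weyl (n + 1)) :
    0 ≤ levelFactor T n x y :=
  mul_nonneg (by split_ifs <;> simp) (pathDensity_nonneg _ y)

theorem ofReal_levelFactor {c : ℕ → ℕ} (T : ∀ n, Fin (c n + 1) → ℝ≥0)
    (x : Fin (c n + 1) → Weyl n) (y : Fin (c (n + 1) + 1) → Weyl (n + 1)) :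
    ENNReal.ofReal (levelFactor T n x y) = if Interlaces (x 0) (y (Fin.last _)) then
      ENNReal.ofReal (pathDensity (T (n + 1)) y) else 0 := by
  rw [levelFactor]
  split_ifs <;> simp

theorem pathDensity_snoc {c : ℕ} (τ : Fin (c + 2) → ℝ≥0) (u : Fin (c + 1) → Weyl n) (x : Weyl n) :
    pathDensity τ (Fin.snoc u x) = pathDensity (fun i => τ i.castSucc) u *
      poissonDet (τ (Fin.last (c + 1)) - τ (Fin.last c).castSucc) (u (Fin.last c)) x := by
  simp only [pathDensity, Fin.prod_univ_castSucc, Fin.succ_castSucc, Fin.succ_last,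
    Fin.snoc_castSucc (α := fun _ => Weyl n), Fin.snoc_last (α := fun _ => Weyl n)]

theorem evolve_fiberSum_last {c : ℕ} (t : ℝ≥0) (F : (Fin (c + 1) → Weyl n) → ℝ≥0∞) (y : Weyl n) :
    evolve t (fiberSum (fun u => u (Fin.last c)) F) y =
      ∑' u, F u * ENNReal.ofReal (poissonDet t (u (Fin.last c)) y) := by
  simp only [evolve, mul_comm _ (ENNReal.ofReal _), ← fiberSum_const_mul]
  exact tsum_fiberSum (fun u : Fin (c + 1) → Weyl n => u (Fin.last c))
    fun x u => ENNReal.ofReal (poissonDet t x y) * F u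

theorem lower_fiberSum_last {c : ℕ} (F : (Fin (c + 1) → Weyl (n + 1)) → ℝ≥0∞) (x : Weyl n) :
    lower (fiberSum (fun u => u (Fin.last c)) F) x =
      ∑' u, if Interlaces x (u (Fin.last c)) then F u else 0 := by
  rw [← tsum_fiberSum (fun u : Fin (c + 1) → Weyl (n + 1) => u (Fin.last c))
    fun y u => if Interlaces x y then F u else 0]
  refine tsum_congr fun y => ?_
  split_ifs with h
  · rfl
  · exact (fiberSum_eq_zero fun _ _ => rfl).symm

theorem HasLevelLaw.chain [IsFiniteMeasure μ] (hX : IsPackedDynamics μ X) {hn : n ≤ N} {c : ℕ}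
    {τ : Fin (c + 1) → ℝ≥0} (hτ : Monotone τ) (P : Fin c → Weyl n → Prop) {k : Weyl n → ℝ≥0∞}
    (hk : HasLevelLaw μ X hn (τ 0) E k) (hE : PastEvent X E (τ 0)) :
    HasLevelLaw μ X hn (τ (Fin.last c)) (E ∩ {ω | ∀ a, P a ((X (τ a.succ) ω).level n hn)})
      (fiberSum (fun u => u (Fin.last c)) fun u =>
        if ∀ a, P a (u a.succ) then k (u 0) * ENNReal.ofReal (pathDensity τ u) else 0) := by
  induction c with
  | zero =>
    convert hk using 1
    · rfl
    · simp
    · funext x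
      rw [fiberSum_last, tsum_eq_single default fun u hu => absurd (Subsingleton.elim u _) hu]
      simp [pathDensity, Fin.snoc]
  | succ c ih =>
    have hτ' : Monotone fun i : Fin (c + 1) => τ i.castSucc := fun i j hij => hτ hij
    have hlaw := ((ih hτ' (fun a => P a.castSucc) hk hE).evolve hX
      (hE.inter_forall hτ' fun a x => P a.castSucc (x.level n hn))
      (hτ (Fin.last c).castSucc_lt_last.le)).observe (P (Fin.last c))
    convert hlaw using 1
    · exact inter_forall_fin_succ' E fun a ω => P a ((X (τ a.succ) ω).level n hn)
    · funext x
      have hcond : ∀ u : Fin (c + 1) → Weyl n,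
          (∀ a : Fin (c + 1), P a (Fin.snoc (α := fun _ => Weyl n) u x a.succ)) ↔
            (∀ a : Fin c, P a.castSucc (u a.succ)) ∧ P (Fin.last c) x := fun u => by
        simp only [Fin.forall_fin_succ', Fin.succ_castSucc, Fin.succ_last,
          Fin.snoc_castSucc (α := fun _ => Weyl n), Fin.snoc_last (α := fun _ => Weyl n)]
      have hzero : ∀ u : Fin (c + 1) → Weyl n, Fin.snoc (α := fun _ => Weyl n) u x 0 = u 0 :=
        fun u => Fin.snoc_castSucc (α := fun _ => Weyl n) x u 0
      simp only [fiberSum_last, evolve_fiberSum_last, hcond, hzero, pathDensity_snoc,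
        ENNReal.ofReal_mul (pathDensity_nonneg _ _)]
      by_cases hx : P (Fin.last c) x <;> simp [hx, mul_assoc]

theorem tsum_config_zero {c : ℕ → ℕ} (hN : 0 ≤ N) {t : ℝ≥0} {k : Weyl 0 → ℝ≥0∞}
    (hk : HasLevelLaw μ X hN t E k) :
    ∑' z : (n : Fin 1) → Fin (c n + 1) → Weyl n, k (z 0 0) = μ E := by
  have hsub (n : Fin 1) : Subsingleton (Weyl n) :=
    ⟨fun x y => Subtype.ext (funext fun i => absurd i.isLt (by omega))⟩
  let z : (n : Fin 1) → Fin (c n + 1) → Weyl n := fun n _ => (packed 0).level n (by omega)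
  rw [tsum_eq_single z fun z' hz' => absurd (Subsingleton.elim z' z) hz']
  refine (hk (packed 0)).symm.trans (congrArg μ (Set.inter_eq_left.2 fun ω _ => ?_))
  exact eq_packed_of_top_eq _ (funext fun i => i.elim0)

theorem tsum_config [IsFiniteMeasure μ] (hX : IsPackedDynamics μ X) {c : ℕ → ℕ}
    {T : ∀ n, Fin (c n + 1) → ℝ≥0} (hT : ∀ n, Monotone (T n)) (P : ∀ n, Fin (c n) → Weyl n → Prop)
    {L : ℕ} (hL : L ≤ N) (hlink : ∀ n < L, T n 0 = T (n + 1) (Fin.last _)) {k : Weyl L → ℝ≥0∞}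
    (hk : HasLevelLaw μ X hL (T L 0) E k) (hE : PastEvent X E (T L 0)) :
    (∑' z : (n : Fin (L + 1)) → Fin (c n + 1) → Weyl n,
      if ∀ (l : Fin L) (a : Fin (c (l + 1))), P (l + 1) a (z l.succ a.succ) then
        k (z (Fin.last L) 0) *
          ∏ l : Fin L, ENNReal.ofReal (levelFactor T l (z l.castSucc) (z l.succ))
      else 0) =
    μ (E ∩ {ω | ∀ (l : Fin L) (a : Fin (c (l + 1))),
      P (l + 1) a ((X (T (l + 1) a.succ) ω).level (l + 1) (by omega))}) := by
  induction L generalizing E with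
  | zero =>
    simpa using tsum_config_zero hL hk
  | succ L ih =>
    have hlaw := hk.chain hX (hT (L + 1)) (P (L + 1)) hE
    have hpast := hE.inter_forall (hT (L + 1)) fun a x => P (L + 1) a (x.level (L + 1) hL)
    rw [← hlink L L.lt_succ_self] at hlaw hpast
    have hevent := inter_forall_fin_succ' E fun (l : Fin (L + 1)) ω => ∀ a : Fin (c (l + 1)),
      P (l + 1) a ((X (T (l + 1) a.succ) ω).level (l + 1) (by omega))
    rw [hevent, Set.inter_right_comm]
    refine Eq.trans ?_ (ih (L.le_succ.trans hL) (fun n hn => hlink n (hn.trans L.lt_succ_self))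
      (hlaw.lower hX) hpast)
    rw [tsum_snoc (β := fun n => Fin (c n + 1) → Weyl n)]
    refine tsum_congr fun z => ?_
    have hprod := fun u => prod_snoc z u fun l x y => ENNReal.ofReal (levelFactor T l x y)
    have hcond := fun u => forall_snoc z u fun n (x : Fin (c n + 1) → Weyl n) =>
      ∀ a : Fin (c n), P n a (x a.succ)
    have hlast := fun u => Fin.snoc_last (α := fun n : Fin (L + 2) => Fin (c n + 1) → Weyl n) u z
    simp only [hprod, hcond, hlast, lower_fiberSum_last]
    split_ifs with hz
    · rw [← ENNReal.tsum_mul_right]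
      refine tsum_congr fun u => ?_
      have hfactor := ofReal_levelFactor (n := L) T (z (Fin.last L)) u
      simp only [hz, implies_true, true_and, hfactor]
      split_ifs <;> ring
    · simp [hz]

end Configurations

/-! ### Levels and times of space-like points -/

theorem mem_iff_val_lt_card {m : ℕ} {S : Finset (Fin m)} (hS : IsLowerSet (S : Set (Fin m)))
    (i : Fin m) : i ∈ S ↔ (i : ℕ) < S.card := by
  constructor
  · intro hi
    have hsub : Finset.Iic i ⊆ S := fun j hj => hS (Finset.mem_Iic.1 hj) hi
    simpa using Finset.card_le_card hsub
  · intro hcard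
    by_contra hi
    have hsub : S ⊆ Finset.Iio i := fun j hj =>
      Finset.mem_Iio.2 (lt_of_not_ge fun hij => hi (hS hij hj))
    exact absurd hcard (by simpa using Finset.card_le_card hsub)

section Levels

variable {m : ℕ} {lev : Fin m → ℕ}

theorem lt_lev_iff (hlev : Antitone lev) (n : ℕ) (i : Fin m) :
    n < lev i ↔ (i : ℕ) < numAbove lev n := by
  have hlower :
      IsLowerSet ((Finset.univ.filter fun i => n < lev i : Finset (Fin m)) : Set (Fin m)) :=
    fun i j hij hi => by simpa using (show n < lev i by simpa using hi).trans_le (hlev hij)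
  simpa [numAbove] using mem_iff_val_lt_card hlower i

theorem numAbove_eq_add (lev : Fin m → ℕ) (n : ℕ) :
    numAbove lev n = numAbove lev (n + 1) + numAt lev (n + 1) := by
  simp only [numAbove, numAt, Finset.card_filter, ← Finset.sum_add_distrib]
  exact Finset.sum_congr rfl fun i _ => by split_ifs <;> omega

theorem numAbove_add_rankAt (hlev : Antitone lev) (i : Fin m) :
    numAbove lev (lev i) + (rankAt lev i : ℕ) = i + 1 := by
  rw [← Fin.card_Iic, ← Finset.filter_ge_eq_Iic]
  simp only [numAbove, rankAt, Finset.card_filter, ← Finset.sum_add_distrib]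
  refine Finset.sum_congr rfl fun j _ => ?_
  have hle := @hlev j i
  have hge := @hlev i j
  split_ifs <;> grind

theorem rankAt_ne_zero (hlev : Antitone lev) (i : Fin m) : (rankAt lev i : ℕ) ≠ 0 := by
  have hrank := numAbove_add_rankAt hlev i
  have hnot := (lt_lev_iff hlev (lev i) i).not.1 (lt_irrefl _)
  omega

/-- The condition that conditions `Q` on the observed values impose on the value with index `a + 1`
on level `n`; there is none if no observed point lies there. -/
def levelCondition (Q : ∀ i, Weyl (lev i) → Prop) (n : ℕ) (a : Fin (numAt lev n)) (x : Weyl n) :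
    Prop :=
  ∀ (i : Fin m) (h : n = lev i), (rankAt lev i : ℕ) = a + 1 → Q i (h ▸ x)

variable [NeZero m] {tm : Fin m → ℝ≥0}

theorem levelTime_rankAt (hlev : Antitone lev) (tm : Fin m → ℝ≥0) (i : Fin m) :
    levelTime lev tm (lev i) (rankAt lev i) = tm i := by
  have hrank := numAbove_add_rankAt hlev i
  rw [levelTime, if_neg fun h => rankAt_ne_zero hlev i h.1]
  exact congrArg tm (Fin.ext (by simp only; omega))

theorem monotone_levelTime (lev : Fin m → ℕ) (htm : Monotone tm) (n : ℕ) :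
    Monotone (levelTime lev tm n) := by
  intro a b hab
  have : (a : ℕ) ≤ b := hab
  unfold levelTime
  split_ifs with ha hb hb
  · exact le_rfl
  · exact htm (Fin.zero_le _)
  · exact absurd ⟨by omega, hb.2⟩ ha
  · exact htm (Fin.mk_le_mk.2 (by omega))

theorem levelTime_zero_eq_last (hlev : Antitone lev) (tm : Fin m → ℝ≥0) {n : ℕ} (hn : n < lev 0) :
    levelTime lev tm n 0 = levelTime lev tm (n + 1) (Fin.last _) := by
  have hadd := numAbove_eq_add lev n
  have hpos : 0 < numAbove lev n := (lt_lev_iff hlev n 0).1 hn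
  rw [levelTime, levelTime, if_neg (by omega), if_neg (by simp only [Fin.val_last]; omega)]
  exact congrArg tm (Fin.ext (by simp only [Fin.val_zero, Fin.val_last]; omega))

theorem levelTime_top_zero (hlev : Antitone lev) (tm : Fin m → ℝ≥0) :
    levelTime lev tm (lev 0) 0 = tm 0 := by
  have hzero : ¬ 0 < numAbove lev (lev 0) := (lt_lev_iff hlev (lev 0) 0).not.1 (lt_irrefl _)
  exact if_pos ⟨rfl, by omega⟩

theorem forall_levelCondition_iff (hlev : Antitone lev) (hpos : ∀ i, 1 ≤ lev i)
    (Q : ∀ i, Weyl (lev i) → Prop) (x : ∀ n, n ≤ lev 0 → Fin (numAt lev n + 1) → Weyl n) :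
    (∀ (l : Fin (lev 0)) (a : Fin (numAt lev (l + 1))),
      levelCondition Q (l + 1) a (x (l + 1) l.isLt a.succ)) ↔
    ∀ i, Q i (x (lev i) (hlev (Fin.zero_le i)) (rankAt lev i)) := by
  have hcast : ∀ (n : ℕ) (hn : n ≤ lev 0) (a : Fin (numAt lev n + 1)) (i : Fin m) (h : n = lev i),
      (rankAt lev i : ℕ) = a → (h ▸ x n hn a : Weyl (lev i)) =
        x (lev i) (hlev (Fin.zero_le i)) (rankAt lev i) := by
    rintro _ hn a i rfl ha
    rw [Fin.ext ha]
  constructor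
  · intro h i
    obtain ⟨l, hl⟩ := Nat.exists_eq_add_of_le' (hpos i)
    have hrank : (rankAt lev i : ℕ) < numAt lev (l + 1) + 1 := hl ▸ (rankAt lev i).isLt
    have hne := rankAt_ne_zero hlev i
    have hle := hlev (Fin.zero_le i)
    have hQ := h ⟨l, by omega⟩ ⟨(rankAt lev i : ℕ) - 1, by simp only; omega⟩ i hl.symm
      (by simp only; omega)
    rwa [hcast _ _ _ _ _ (by simp only [Fin.val_succ]; omega)] at hQ
  · intro h l a i hi ha
    rw [hcast _ _ _ _ _ (by simpa using ha)]
    exact h i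

end Levels

/-! ### The normalized weight -/

theorem hasSum_of_tsum_ofReal {ι : Type*} {f : ι → ℝ} (hf : ∀ i, 0 ≤ f i) {v : ℝ≥0∞}
    (hv : v ≠ ∞) (h : ∑' i, ENNReal.ofReal (f i) = v) : HasSum f v.toReal := by
  have hsum := ENNReal.hasSum_toReal (h.trans_ne hv)
  rw [← ENNReal.tsum_toReal_eq fun i => ENNReal.ofReal_ne_top, h] at hsum
  simpa only [ENNReal.toReal_ofReal (hf _)] using hsum

/-- The normalizing constant of the weight with top level `n` and first time `t`. The signs are
those of the determinants of `φ` on interlacing configurations, the powers of `t` come from the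
transition determinant started from the packed configuration. -/
def normalizer (n : ℕ) (t : ℝ≥0) : ℝ :=
  ∏ l : Fin n, (-1) ^ (l : ℕ) * ((t : ℝ) ^ (l : ℕ))⁻¹

section Weight

variable {m : ℕ} [NeZero m] {lev : Fin m → ℕ} {tm : Fin m → ℝ≥0}

theorem levelFactor_eq_phiDet {c : ℕ → ℕ} (T : ∀ n, Fin (c n + 1) → ℝ≥0) {n : ℕ}
    (x : Fin (c n + 1) → Weyl n) (y : Fin (c (n + 1) + 1) → Weyl (n + 1)) :
    levelFactor T n x y =
      (-1) ^ n * (phiDet (x 0) (y (Fin.last _)) * pathDensity (T (n + 1)) y) := by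
  rw [levelFactor, ← mul_assoc, neg_one_pow_mul_phiDet (x 0).2 (y (Fin.last _)).2.monotone]

theorem normalizer_mul_weight (ht : tm 0 ≠ 0) (z : Config lev) :
    normalizer (lev 0) (tm 0) * weight lev tm z =
      poissonDet (tm 0) (packed (lev 0)).top (z (Fin.last _) 0) *
        ∏ l : Fin (lev 0),
          levelFactor (c := numAt lev) (levelTime lev tm) l (z l.castSucc) (z l.succ) := by
  have hfactor (l : Fin (lev 0)) := levelFactor_eq_phiDet (c := numAt lev) (levelTime lev tm)
    (n := l) (z l.castSucc) (z l.succ)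
  rw [Finset.prod_congr rfl fun l _ => hfactor l, top_packed, poissonDet_packed ht,
    Finset.prod_mul_distrib, normalizer, Finset.prod_mul_distrib]
  have hcomm (a b x v w : ℝ) : a * b * (x * v * w) = b * (v * w) * (a * x) := by ring
  exact hcomm _ _ _ _ _

theorem normalizer_mul_weight_nonneg (ht : tm 0 ≠ 0) (z : Config lev) :
    0 ≤ normalizer (lev 0) (tm 0) * weight lev tm z := by
  rw [normalizer_mul_weight ht]
  exact mul_nonneg (poissonDet_nonneg _ (packed (lev 0)).strictMono_top (z (Fin.last _) 0).2)
    (Finset.prod_nonneg fun l _ => levelFactor_nonneg _ _ _)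

variable {Ω : Type*} [MeasurableSpace Ω] {μ : Measure Ω} [IsProbabilityMeasure μ]
  {N : ℕ} {X : ℝ≥0 → Ω → GT N}

theorem IsPackedDynamics.hasSum_weight_observed (hX : IsPackedDynamics μ X) (hlev : Antitone lev)
    (htm : Monotone tm) (hpos : ∀ i, 1 ≤ lev i) (hN : lev 0 ≤ N) (ht : tm 0 ≠ 0)
    (Q : ∀ i, Weyl (lev i) → Prop) :
    HasSum
      (Set.indicator {z | ∀ i, Q i (observed lev (fun i => hlev (Fin.zero_le i)) z i)}
        fun z => normalizer (lev 0) (tm 0) * weight lev tm z)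
      (μ.real {ω | ∀ i, Q i ((X (tm i) ω).level (lev i) ((hlev (Fin.zero_le i)).trans hN))}) := by
  refine hasSum_of_tsum_ofReal
    (Set.indicator_nonneg fun z _ => normalizer_mul_weight_nonneg ht z) (measure_ne_top μ _) ?_
  have hchain := tsum_config hX (monotone_levelTime lev htm) (levelCondition Q)
    hN (fun n hn => levelTime_zero_eq_last hlev tm hn)
    (hX.hasLevelLaw hN (levelTime lev tm (lev 0) 0)) (pastEvent_univ X _)
  have hprocess (ω : Ω) := forall_levelCondition_iff hlev hpos Q fun n hn a =>
    (X (levelTime lev tm n a) ω).level n (hn.trans hN)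
  have hconfig (z : Config lev) := forall_levelCondition_iff hlev hpos Q fun n hn a =>
    z ⟨n, Nat.lt_succ_of_le hn⟩ a
  simp only [levelTime_rankAt hlev] at hprocess
  simp only [hprocess, levelTime_top_zero hlev, Set.univ_inter] at hchain
  rw [← hchain]
  refine tsum_congr fun z => ?_
  have hweight := congrArg ENNReal.ofReal (normalizer_mul_weight ht z)
  rw [ENNReal.ofReal_mul (poissonDet_nonneg _ (packed (lev 0)).strictMono_top (z (Fin.last _) 0).2),
    ENNReal.ofReal_prod_of_nonneg fun l _ => levelFactor_nonneg _ _ _] at hweight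
  rw [Set.indicator_apply, apply_ite ENNReal.ofReal, ENNReal.ofReal_zero, hweight]
  exact if_congr (hconfig z).symm rfl rfl

end Weight

end GTDynamics

end

open GTDynamics in
theorem mainTheorem4 {Ω : Type*} [MeasurableSpace Ω] (μ : Measure Ω) [IsProbabilityMeasure μ]
    (N : ℕ) (X : ℝ≥0 → Ω → GT N) (hX : IsPackedDynamics μ X)
    (m : ℕ) [NeZero m] (lev : Fin m → ℕ) (tm : Fin m → ℝ≥0)
    (hpos : ∀ i, 1 ≤ lev i) (hN : lev 0 ≤ N) (ht : 0 < tm 0)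
    (hsl : ∀ i j, i < j → SpaceLike (lev i, tm i) (lev j, tm j)) :
    ∃ C : ℝ,
      (∀ z : Config lev, 0 ≤ C * weight lev tm z) ∧
      HasSum (fun z : Config lev => C * weight lev tm z) 1 ∧
      ∀ y : (i : Fin m) → Weyl (lev i),
        HasSum
          (Set.indicator {z : Config lev | ∀ i, observed lev (SpaceLike.level_le_top hsl) z i = y i}
            (fun z => C * weight lev tm z))
          (μ.real {ω | ∀ i, (X (tm i) ω).level (lev i) ((SpaceLike.level_le_top hsl i).trans hN) = y i}) := by
  have hlev : Antitone lev := fun i j hij => hij.lt_or_eq.elim (fun h => (hsl i j h).1)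
    fun h => (congrArg lev h.symm).le
  have htm : Monotone tm := fun i j hij => hij.lt_or_eq.elim (fun h => (hsl i j h).2.1)
    fun h => (congrArg tm h).le
  have hsum := hX.hasSum_weight_observed hlev htm hpos hN ht.ne'
  refine ⟨normalizer (lev 0) (tm 0), normalizer_mul_weight_nonneg ht.ne', ?_,
    fun y => hsum fun i x => x = y i⟩
  simpa using hsum fun _ _ => True
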